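/- Let $\mathbb F$ be a skew field and $\mathbb P=\mathbb P(V)$ the (Desarguesian) projective geometry of a left $\mathbb F$-vector space $V$. Graphs may be infinite, with links (two distinct endpoints), multiple links and half edges (one endpoint); a circle is the edge set of a simple closed path. A biased graph $\Omega$ is a graph with a class of circles, called balanced, such that no theta subgraph contains exactly two balanced circles. Its extended lift matroid $L_0(\Omega)$ on $E\cup\{e_0\}$ has the closure operator $S\mapsto S\cup\{e: e\in C\subseteq S\cup\{e\}\text{ for some balanced circle }C\}$ if $S\subseteq E$ is balanced (no half edges, all circles balanced), and $S\mapsto \operatorname{clos}(S\cap E)\cup\{e_0\}$ otherwise, where $\operatorname{clos}(S')$ is the set of edges whose endpoints are joined by a path in $S'$. All matroids are assumed to be simple; for $L_0(\Omega)$ this means that $\Omega$ has no half edges and no balanced circles of length 2. *Synthetic orthographic representations.* Let $\mathbb P'$ be a hyperplane of $\mathbb P$, let $\mathbf z'$ be a projective representation in $\mathbb P'$ of the graphic matroid of a simple graph $\Delta$, and let $\hat e_0$ be a point not in $\mathbb P'$. The lines $\mathbf z'(d)\hat e_0$, $d\in E(\Delta)$, are the edge lines. For a set $\hat E$ of points other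 than $\hat e_0$ on the edge lines, let $\Omega_0(\hat E)$ be the graph with the nodes of $\Delta$ and one edge $e$ for each point $\hat e\in\hat E$, with the endpoints of the edge $d$ of $\Delta$ whose edge line contains $\hat e$, where a circle $C$ is called balanced if the flat spanned by $\{\hat e: e\in C\}$ does not contain $\hat e_0$. If $\Omega\cong\Omega_0(\hat E)$, then $\hat E$, with $e\mapsto\hat e$ and $e_0\mapsto\hat e_0$, is a synthetic orthographic representation of $L_0(\Omega)$. *Analytic orthographic representations.* Let $\Phi$ be a gain graph with node set $N$ and gains $\varphi$ in the additive group $\mathbb F^+$, so that $\varphi(e_{wv})=-\varphi(e_{vw})$; its biased graph $\langle\Phi\rangle$ has as balanced circles those of gain $0$. Let $\mathbb F^N$ be the vector space with basis $\{\hat v:v\in N\}$. The analytic orthographic representation of $\Phi$ in $\mathbb F\times\mathbb F^N$ is $\mathbf z_\Phi(e)=(\varphi(e_{vw}),\hat w-\hat v)$ for a link $e=e_{vw}$, and $\mathbf z_\Phi(e)=(1,\mathbf 0)$ for a half edge or $e=e_0$. Its central projection $\bar{\mathbf z}_\Phi$ takes each $e$ to the projective point (line through the origin) containing $\mathbf z_\Phi(e)$.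 **Theorem.** The synthetic orthographic representations of extended lift matroids of biased graphs in projective geometries over $\mathbb F$ are, up to a choice of coordinates, the same as the central projections of the analytic orthographic representations of the gain graphs $\Phi$ with gains in $\mathbb F^+$ (for which $L_0(\langle\Phi\rangle)$ is simple). Precisely: (1) Let $\Phi$ be a gain graph with gains in $\mathbb F^+$ and node set $N$ such that $L_0(\langle\Phi\rangle)$ is simple. Then $\bar{\mathbf z}_\Phi$ is a synthetic orthographic representation of $\langle\Phi\rangle$ in $\mathbb P(\mathbb F\times\mathbb F^N)$, where $\mathbb P'$ is the hyperplane of $0\times\mathbb F^N$, $\hat e_0=[1,\mathbf 0]$, $\Delta$ is the simplification of the underlying graph of $\Phi$, and $\mathbf z'(d_{vw})=[0,\hat w-\hat v]$; and it is a projective representation of $L_0(\langle\Phi\rangle)$. More generally, let $T:V\to\mathbb F\times\mathbb F^N$ be a linear map, and let $z:E(\Phi)\cup\{e_0\}\to\mathbb P(V)$ be such that $T$ is injective on the span of the image of $z$ and takes $z$ to $\bar{\mathbf z}_\Phi$. Then $z$ is a synthetic orthographic representation of $\langle\Phi\rangle$, with $\mathbb P'$ the hyperplane of $T^{-1}(0\times\mathbb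 F^N)$, with the same $\Delta$, and with a $\mathbf z'$ that $T$ takes to $d_{vw}\mapsto[0,\hat w-\hat v]$; and it is a projective representation of $L_0(\langle\Phi\rangle)$. (2) Conversely, in $\mathbb P(V)$ let $\mathbb P',\Delta,\mathbf z',\hat e_0,\hat E$ be as above and let $\Omega$, with node set $N$, be isomorphic to $\Omega_0(\hat E)$. Then $\Omega$ is a biased graph, $L_0(\Omega)$ is simple and is represented by $e\mapsto\hat e$, $e_0\mapsto\hat e_0$, and there are a gain graph $\Phi$ with gains in $\mathbb F^+$ such that $\langle\Phi\rangle=\Omega$, and a linear map $T:V\to\mathbb F\times\mathbb F^N$ that is injective on the span of $\hat e_0$ and $\mathbf z'(E(\Delta))$, such that $\mathbb P'$ is the hyperplane of $T^{-1}(0\times\mathbb F^N)$, and $T$ takes $\hat e_0$ to $[1,\mathbf 0]$, $\mathbf z'(d_{vw})$ to $[0,\hat w-\hat v]$ for every edge $d_{vw}$ of $\Delta$ (its nodes being identified with those of $\Omega$), and $\hat e$ to $\bar{\mathbf z}_\Phi(e)$ for every edge $e$ of $\Omega$. -/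

import Mathlib

open scoped LinearAlgebra.Projectivization

namespace OrthoLift

/-! ### Graphs, circles, theta graphs -/

/-- A graph with node set `N` and edge set `E`; multiple edges are allowed.  An edge `e` with
`ends e = s(v, w)`, `v ≠ w`, is a link with endpoints `v` and `w`; an edge `e` with
`ends e = s(v, v)` is a half edge at `v`. -/
@[ext]
structure EGraph (N E : Type*) where
  /-- the endpoints of an edge -/
  ends : E → Sym2 N

namespace EGraph

variable {N E : Type*} (G : EGraph N E)

/-- `e` is a half edge. -/
def IsHalfEdge (e : E) : Prop := (G.ends e).IsDiag

/-- `v 0, e 0, v 1, e 1, …, v (n + 1), e (n + 1), v 0` is a simple closed path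
(of length `n + 2 ≥ 2`; the addition in `Fin (n + 2)` is cyclic). -/
def IsClosedPath {n : ℕ} (v : Fin (n + 2) → N) (e : Fin (n + 2) → E) : Prop :=
  Function.Injective v ∧ Function.Injective e ∧ ∀ i, G.ends (e i) = s(v i, v (i + 1))

/-- A circle is the edge set of a simple closed path. -/
def IsCircle (C : Set E) : Prop :=
  ∃ (n : ℕ) (v : Fin (n + 2) → N) (e : Fin (n + 2) → E),
    G.IsClosedPath v e ∧ Set.range e = C

/-- `X` and `P` are the node set and the edge set of a path from `a` to `b`. -/
def IsPath (a b : N) (X : Set N) (P : Set E) : Prop :=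
  ∃ (n : ℕ) (v : Fin (n + 1) → N) (e : Fin n → E),
    Function.Injective v ∧ v 0 = a ∧ v (Fin.last n) = b ∧
    (∀ i : Fin n, G.ends (e i) = s(v i.castSucc, v i.succ)) ∧
    Set.range v = X ∧ Set.range e = P

/-- `P`, `Q`, `R` are the edge sets of three internally disjoint paths with the same two
(distinct) endpoints, so that their union is a theta graph. -/
def IsTheta (P Q R : Set E) : Prop :=
  ∃ (a b : N) (X Y Z : Set N), a ≠ b ∧
    G.IsPath a b X P ∧ G.IsPath a b Y Q ∧ G.IsPath a b Z R ∧
    X ∩ Y = {a, b} ∧ Y ∩ Z = {a, b} ∧ X ∩ Z = {a, b} ∧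
    Disjoint P Q ∧ Disjoint Q R ∧ Disjoint P R

/-- `a` and `b` are joined by a path in the spanning subgraph with edge set `S`. -/
def Joined (S : Set E) : N → N → Prop :=
  Relation.ReflTransGen fun a b => ∃ e ∈ S, G.ends e = s(a, b)

/-- Closure in the graphic matroid: all edges whose endpoints are joined by `S`. -/
def closure (S : Set E) : Set E :=
  {e | ∀ a b, G.ends e = s(a, b) → G.Joined S a b}

/-- The simplification: one edge for each class of parallel links. -/
def simplification : SimpleGraph N where
  Adj a b := a ≠ b ∧ ∃ e, G.ends e = s(a, b)
  symm := ⟨fun _ _ h => ⟨h.1.symm, h.2.imp fun _ he => he.trans Sym2.eq_swap⟩⟩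
  loopless := ⟨fun _ h => h.1 rfl⟩

end EGraph

/-- A simple graph, with its own edges as edge set. -/
def ofSimple {N : Type*} (Δ : SimpleGraph N) : EGraph N Δ.edgeSet where
  ends e := e.1

/-! ### Biased graphs and the extended lift matroid -/

/-- A graph with a class of circles, called balanced. -/
@[ext]
structure CircleGraph (N E : Type*) extends EGraph N E where
  /-- the class of balanced circles -/
  balanced : Set (Set E)
  balanced_isCircle : ∀ C ∈ balanced, toEGraph.IsCircle C

namespace CircleGraph

variable {N E : Type*} (Ω : CircleGraph N E)

/-- The balanced circles form a linear class: no theta subgraph has exactly two balanced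
circles. -/
def IsBiasedGraph : Prop :=
  ∀ P Q R : Set E, Ω.IsTheta P Q R →
    P ∪ Q ∈ Ω.balanced → Q ∪ R ∈ Ω.balanced → P ∪ R ∈ Ω.balanced

/-- An edge set is balanced if it has no half edges and every circle in it is balanced. -/
def IsBalancedSet (S : Set E) : Prop :=
  (∀ e ∈ S, ¬ Ω.IsHalfEdge e) ∧ ∀ C ⊆ S, Ω.IsCircle C → C ∈ Ω.balanced

/-- The balance-closure of an edge set. -/
def balanceClosure (S : Set E) : Set E :=
  S ∪ {e | ∃ C ∈ Ω.balanced, e ∈ C ∧ C ⊆ insert e S}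

open Classical in
/-- The closure operator of the extended lift matroid, whose ground set is the edge set with
one more element `e₀`, which is `none` here. -/
noncomputable def liftClosure (S : Set (Option E)) : Set (Option E) :=
  if none ∉ S ∧ Ω.IsBalancedSet (some ⁻¹' S) then
    some '' Ω.balanceClosure (some ⁻¹' S)
  else
    insert none (some '' Ω.closure (some ⁻¹' S))

/-- The extended lift matroid is simple: there are no half edges (which would be parallel to
`e₀`) and no balanced digons. -/
def IsLiftSimple : Prop :=
  (∀ e, ¬ Ω.IsHalfEdge e) ∧ ∀ C ∈ Ω.balanced, C.encard ≠ 2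

end CircleGraph

/-- An isomorphism of the underlying graphs that preserves balance and imbalance of circles. -/
structure CircleGraph.Iso {N E N' E' : Type*} (Ω : CircleGraph N E) (Ω' : CircleGraph N' E') where
  /-- the bijection of nodes -/
  node : N ≃ N'
  /-- the bijection of edges -/
  edge : E ≃ E'
  ends_edge : ∀ e, Ω'.ends (edge e) = (Ω.ends e).map node
  balanced_iff : ∀ C : Set E, edge '' C ∈ Ω'.balanced ↔ C ∈ Ω.balanced

/-! ### Projective representations -/

section Projective

variable {F V : Type*} [DivisionRing F] [AddCommGroup V] [Module F V]

/-- The flat spanned by a set of projective points, as a vector subspace. -/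
def flatSpan (S : Set (ℙ F V)) : Submodule F V := ⨆ p ∈ S, p.submodule

/-- `z` is a projective representation (embedding) of the matroid on `α` with closure
operator `cl`. -/
def IsProjRep {α : Type*} (cl : Set α → Set α) (z : α → ℙ F V) : Prop :=
  Function.Injective z ∧ ∀ (S : Set α) (x : α), x ∈ cl S ↔ (z x).submodule ≤ flatSpan (z '' S)

variable (F V) in
/-- The data from which synthetic orthographic representations are constructed, in the
projective geometry of the vector space `V` over `F`. -/
structure OrthoFrame (N : Type*) where
  /-- the base hyperplane -/
  base : Submodule F V
  isCoatom_base : IsCoatom base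
  /-- the simple graph that is represented in the base hyperplane -/
  graph : SimpleGraph N
  /-- the representation of its graphic matroid -/
  basePt : graph.edgeSet → ℙ F V
  basePt_mem : ∀ d, (basePt d).submodule ≤ base
  basePt_rep : IsProjRep (ofSimple graph).closure basePt
  /-- the point that represents `e₀` -/
  apex : ℙ F V
  apex_not_mem : ¬ apex.submodule ≤ base

namespace OrthoFrame

variable {N : Type*} (D : OrthoFrame F V N)

/-- The edge line of an edge of the simple graph, as a vector subspace. -/
def edgeLine (d : D.graph.edgeSet) : Submodule F V := (D.basePt d).submodule ⊔ D.apex.submodule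

/-- The union of the edge lines, without the apex. -/
def edgePoints : Set (ℙ F V) :=
  {p | p ≠ D.apex ∧ ∃ d, p.submodule ≤ D.edgeLine d}

/-- Each point in the union of the edge lines, other than the apex, is in only one of them. -/
theorem edgeLine_unique {p : ℙ F V} (hp : p ≠ D.apex) {d d' : D.graph.edgeSet}
    (h : p.submodule ≤ D.edgeLine d) (h' : p.submodule ≤ D.edgeLine d') : d = d' := by
  apply D.basePt_rep.1
  have hd := D.basePt_mem d
  have hd' := D.basePt_mem d'
  have hb := D.apex_not_mem
  unfold edgeLine at h h'
  rw [Projectivization.submodule_eq] at hd hd' hb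
  rw [Projectivization.submodule_eq p, Projectivization.submodule_eq D.apex,
    Projectivization.submodule_eq (D.basePt _)] at h h'
  rw [Submodule.span_singleton_le_iff_mem] at h h' hd hd' hb
  rw [Submodule.mem_sup] at h h'
  obtain ⟨y, hy, t, ht, hyt⟩ := h
  obtain ⟨y', hy', t', ht', hyt'⟩ := h'
  rw [Submodule.mem_span_singleton] at hy hy' ht ht'
  obtain ⟨a, rfl⟩ := hy
  obtain ⟨a', rfl⟩ := hy'
  obtain ⟨c, rfl⟩ := ht
  obtain ⟨c', rfl⟩ := ht'
  have h1 : (c - c') • D.apex.rep ∈ D.base := by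
    have : (c - c') • D.apex.rep = a' • (D.basePt d').rep - a • (D.basePt d).rep := by
      rw [sub_smul, sub_eq_sub_iff_add_eq_add, add_comm, hyt, hyt']
    rw [this]
    exact D.base.sub_mem (D.base.smul_mem _ hd') (D.base.smul_mem _ hd)
  have hc : c - c' = 0 := by
    by_contra hne
    exact hb ((D.base.smul_mem_iff hne).1 h1)
  obtain rfl : c = c' := sub_eq_zero.1 hc
  have h2 : a • (D.basePt d).rep = a' • (D.basePt d').rep := by
    have := hyt.trans hyt'.symm
    exact add_right_cancel this
  have ha : a ≠ 0 := by
    rintro rfl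
    rw [zero_smul, zero_add] at hyt
    have hc0 : c ≠ 0 := by
      rintro rfl
      exact p.rep_nonzero (by rw [← hyt, zero_smul])
    apply hp
    rw [← p.mk_rep, ← D.apex.mk_rep, Projectivization.mk_eq_mk_iff']
    exact ⟨c, hyt⟩
  rw [← (D.basePt d).mk_rep, ← (D.basePt d').mk_rep, Projectivization.mk_eq_mk_iff']
  exact ⟨a⁻¹ * a', by rw [mul_smul, ← h2, smul_smul, inv_mul_cancel₀ ha, one_smul]⟩

/-- The graph with a class of circles that is constructed from a subset of the edge points.  Its
edges are the points; a point is an edge parallel to the edge of the simple graph whose edge line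
it is in; a circle is balanced if it spans a cross-flat, that is, a flat without the apex. -/
noncomputable def omega (P : Set (ℙ F V)) (hP : P ⊆ D.edgePoints) : CircleGraph N P where
  ends p := (Classical.choose (hP p.2).2).1
  balanced := {C |
    EGraph.IsCircle ⟨fun p : P => (Classical.choose (hP p.2).2).1⟩ C ∧
      ¬ D.apex.submodule ≤ flatSpan (Subtype.val '' C)}
  balanced_isCircle _ hC := hC.1

end OrthoFrame

end Projective

/-! ### Gain graphs with additive gains -/

/-- A gain graph with gains in the additive group of `F`.  Each edge is given with an orientation
and with its gain in that direction; its gain in the opposite direction is the negative.  (Gains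
of half edges have no meaning and are never used.) -/
structure GainGraph (N E F : Type*) where
  /-- the endpoint where the edge begins -/
  tail : E → N
  /-- the endpoint where the edge ends -/
  head : E → N
  /-- the gain in the direction from `tail` to `head` -/
  gain : E → F

namespace GainGraph

variable {N E F : Type*} [DivisionRing F] (Φ : GainGraph N E F)

/-- The underlying graph. -/
def graph : EGraph N E where
  ends e := s(Φ.tail e, Φ.head e)

open Classical in
/-- The gain of a link in the direction that leaves its endpoint `a`. -/
noncomputable def gainFrom (a : N) (e : E) : F :=
  if a = Φ.tail e then Φ.gain e else -Φ.gain e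

/-- The biased graph of a gain graph: a circle is balanced if its gain is the identity. -/
noncomputable def biased : CircleGraph N E where
  toEGraph := Φ.graph
  balanced := {C | ∃ (n : ℕ) (v : Fin (n + 2) → N) (e : Fin (n + 2) → E),
    Φ.graph.IsClosedPath v e ∧ Set.range e = C ∧ ∑ i, Φ.gainFrom (v i) (e i) = 0}
  balanced_isCircle := by
    rintro C ⟨n, v, e, h, hC, -⟩
    exact ⟨n, v, e, h, hC⟩

open Classical in
/-- The analytic orthographic representation, on the edges and `e₀` (which is `none`): a link
from `v` to `w` goes to the vector `(φ(e), w - v)`; a half edge or `e₀` goes to `(1, 0)`. -/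
noncomputable def liftVec : Option E → F × (N →₀ F)
  | none => (1, 0)
  | some e =>
    if Φ.tail e = Φ.head e then (1, 0)
    else (Φ.gain e, Finsupp.single (Φ.head e) 1 - Finsupp.single (Φ.tail e) 1)

theorem liftVec_ne_zero (x : Option E) : Φ.liftVec x ≠ 0 := by
  classical
  rcases x with _ | e
  · simp [liftVec]
  · simp only [liftVec]
    split_ifs with h
    · simp
    · intro h0
      have h1 := DFunLike.congr_fun (Prod.ext_iff.1 h0).2 (Φ.head e)
      simp [h] at h1

/-- The projection from the origin (central projection) of the analytic representation. -/
noncomputable def liftPt (x : Option E) : ℙ F (F × (N →₀ F)) :=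
  Projectivization.mk F (Φ.liftVec x) (Φ.liftVec_ne_zero x)

end GainGraph

end OrthoLift

open OrthoLift

namespace OrthoLift

/-! ### Paths, circles and connection in multigraphs. -/

namespace EGraph

variable {N E : Type*} {G : EGraph N E}

/-! Everything rests on potentials. A circle has gain zero exactly when some `θ : N → F` has the
gain of each of its edges as its difference. Then the linear form `(x, y) ↦ x - ∑ y_v θ_v` kills the
vectors of the edges and is `1` at `(1, 0)`, so the circle does not span `(1, 0)`. If the gain is
not zero, the oriented sum of the vectors is a nonzero multiple of `(1, 0)`. Balance is thus the
absence of the apex from the span, which is the synthetic definition. The same form, with the form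
that sums coordinates over a component of an edge set, determines all spans of the vectors and gives
`mem_liftClosure_iff`. A map that is injective on the span of the points carries these facts to `V`
(`le_flatSpan_iff_mem_span`).

The converse needs projective uniqueness of representations of graphic matroids over a skew field
(`exists_standard_coordinates`). For each node a linear form is found that is nonzero exactly at the
points of the incident edges (`exists_nodeForm`). Rescaling the forms so that the two values on each
edge are opposite (`exists_scaling`) gives the coordinates in which an edge from `a` to `b` is `b -
a`. Adding a form with kernel the base hyperplane and value `1` at the apex gives `T`. A point other
than the apex on an edge line is then `[g, b - a]`, and `g` is its gain.

The rescaling and the description of balanced sets are the same problem, solved for any group by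
`exists_isPotential`: gains on a possibly infinite graph have a potential if they do so on each
circle. It is applied to `Fˣ` and to the additive group of `F`. -/

theorem isCircle_of_nat (n : ℕ) (v : ℕ → N) (e : ℕ → E)
    (hv : ∀ i j, i < n + 2 → j < n + 2 → v i = v j → i = j)
    (he : ∀ i j, i < n + 2 → j < n + 2 → e i = e j → i = j)
    (h : ∀ i < n + 2, G.ends (e i) = s(v i, v (i + 1))) (hn : v (n + 2) = v 0) :
    G.IsCircle (e '' Set.Iio (n + 2)) := by
  refine ⟨n, fun i => v i, fun i => e i, ⟨fun i j hij => Fin.ext (hv _ _ i.2 j.2 hij),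
    fun i j hij => Fin.ext (he _ _ i.2 j.2 hij), fun i => ?_⟩, ?_⟩
  · rw [h i i.2]
    suffices hi : v (i.1 + 1) = v (i + 1 : Fin (n + 2)) by rw [hi]
    rcases Nat.lt_or_ge (i.1 + 1) (n + 2) with hi | hi
    · rw [Fin.val_add_one_of_lt' hi]
    · have : i = Fin.last (n + 1) := Fin.ext (by simp; omega)
      rw [this, Fin.last_add_one]
      exact hn
  · ext x
    constructor
    · rintro ⟨i, rfl⟩
      exact ⟨i, i.2, rfl⟩
    · rintro ⟨i, hi, rfl⟩
      exact ⟨⟨i, hi⟩, rfl⟩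

/-- Indices in `ℕ` make it easy to reverse and concatenate paths. Distinct ends force at least one
edge, hence the length `n + 1`. -/
theorem IsPath.exists_nat {a b : N} {X : Set N} {P : Set E} (h : G.IsPath a b X P) (hab : a ≠ b) :
    ∃ (n : ℕ) (v : ℕ → N) (e : ℕ → E), (∀ i j, i ≤ n + 1 → j ≤ n + 1 → v i = v j → i = j) ∧
      v 0 = a ∧ v (n + 1) = b ∧ (∀ i < n + 1, G.ends (e i) = s(v i, v (i + 1))) ∧
      X = v '' Set.Iic (n + 1) ∧ P = e '' Set.Iio (n + 1) := by
  obtain ⟨n, v, e, hv, h0, hl, he, rfl, rfl⟩ := h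
  rcases n with _ | n
  · exact absurd (h0.symm.trans hl) hab
  have hv' : ∀ i (hi : i < n + 2), v (Fin.ofNat (n + 2) i) = v ⟨i, hi⟩ := fun i hi =>
    congrArg v (Fin.ext (Nat.mod_eq_of_lt hi))
  have he' : ∀ i (hi : i < n + 1), e (Fin.ofNat (n + 1) i) = e ⟨i, hi⟩ := fun i hi =>
    congrArg e (Fin.ext (Nat.mod_eq_of_lt hi))
  refine ⟨n, fun i => v (Fin.ofNat _ i), fun i => e (Fin.ofNat _ i), ?_, ?_, ?_, ?_, ?_, ?_⟩
  · intro i j hi hj hij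
    simp only [hv' i (by omega), hv' j (by omega)] at hij
    simpa using hv hij
  · exact h0
  · simp only [hv' (n + 1) (by omega)]
    exact hl
  · intro i hi
    simp only [hv' i (by omega), hv' (i + 1) (by omega), he' i hi]
    exact he ⟨i, hi⟩
  · ext x
    constructor
    · rintro ⟨i, rfl⟩
      exact ⟨i, Nat.lt_succ_iff.1 i.2, hv' i i.2⟩
    · rintro ⟨i, hi, rfl⟩
      exact ⟨_, rfl⟩
  · ext x
    constructor
    · rintro ⟨i, rfl⟩
      exact ⟨i, i.2, he' i i.2⟩
    · rintro ⟨i, hi, rfl⟩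
      exact ⟨_, rfl⟩

theorem IsPath.isCircle_union {a b : N} {X Y : Set N} {P Q : Set E} (hP : G.IsPath a b X P)
    (hQ : G.IsPath a b Y Q) (hab : a ≠ b) (hXY : X ∩ Y = {a, b}) (hPQ : Disjoint P Q) :
    G.IsCircle (P ∪ Q) := by
  obtain ⟨n, v, e, hv, hv0, hvl, he, rfl, rfl⟩ := hP.exists_nat hab
  obtain ⟨m, w, d, hw, hw0, hwl, hd, rfl, rfl⟩ := hQ.exists_nat hab
  have hmeet : ∀ i j, i ≤ n + 1 → j ≤ m + 1 → v i = w j →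
      (i = 0 ∧ j = 0) ∨ (i = n + 1 ∧ j = m + 1) := by
    intro i j hi hj hij
    have : v i ∈ ({a, b} : Set N) := hXY ▸ ⟨⟨i, hi, rfl⟩, ⟨j, hj, hij.symm⟩⟩
    rcases this with h | h
    · exact Or.inl ⟨hv _ _ hi (by omega) (h.trans hv0.symm),
        hw _ _ hj (by omega) (hij.symm.trans (h.trans hw0.symm))⟩
    · exact Or.inr ⟨hv _ _ hi (by omega) (h.trans hvl.symm),
        hw _ _ hj (by omega) (hij.symm.trans (h.trans hwl.symm))⟩
  have einj : ∀ i j, i < n + 1 → j < n + 1 → e i = e j → i = j := by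
    intro i j hi hj hij
    have h1 := (he i hi).symm.trans ((congrArg _ hij).trans (he j hj))
    rw [Sym2.eq_iff] at h1
    rcases h1 with h1 | h1
    · exact hv _ _ (by omega) (by omega) h1.1
    · have := hv _ _ (by omega) (by omega) h1.1
      have := hv _ _ (by omega) (by omega) h1.2
      omega
  have dinj : ∀ i j, i < m + 1 → j < m + 1 → d i = d j → i = j := by
    intro i j hi hj hij
    have h1 := (hd i hi).symm.trans ((congrArg _ hij).trans (hd j hj))
    rw [Sym2.eq_iff] at h1
    rcases h1 with h1 | h1
    · exact hw _ _ (by omega) (by omega) h1.1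
    · have := hw _ _ (by omega) (by omega) h1.1
      have := hw _ _ (by omega) (by omega) h1.2
      omega
  have edne : ∀ i j, i < n + 1 → j < m + 1 → e i ≠ d j := fun i j hi hj hij =>
    Set.disjoint_left.1 hPQ ⟨i, hi, rfl⟩ ⟨j, hj, hij.symm⟩
  -- The circle follows `P` forwards from `a` to `b` and then `Q` backwards; it has `n + m + 2`
  -- edges.
  have hu : e '' Set.Iio (n + 1) ∪ d '' Set.Iio (m + 1) =
      (fun i => if i < n + 1 then e i else d (n + m + 1 - i)) '' Set.Iio (n + m + 2) := by
    ext x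
    constructor
    · rintro (⟨i, hi, rfl⟩ | ⟨i, hi, rfl⟩)
      · rw [Set.mem_Iio] at hi
        exact ⟨i, by rw [Set.mem_Iio]; omega, by simp only [if_pos hi]⟩
      · rw [Set.mem_Iio] at hi
        refine ⟨n + m + 1 - i, by rw [Set.mem_Iio]; omega, ?_⟩
        simp only
        rw [if_neg (by omega)]
        congr 1
        omega
    · rintro ⟨i, hi, rfl⟩
      rw [Set.mem_Iio] at hi
      simp only
      split_ifs with h
      · exact Or.inl ⟨i, h, rfl⟩
      · exact Or.inr ⟨_, by rw [Set.mem_Iio]; omega, rfl⟩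
  rw [hu]
  apply isCircle_of_nat (n + m) (fun i => if i < n + 1 then v i else w (n + m + 2 - i))
  · intro i j hi hj hij
    split_ifs at hij with h1 h2 h2
    · exact hv _ _ (by omega) (by omega) hij
    · have := hmeet _ _ (by omega) (by omega) hij
      omega
    · have := hmeet _ _ (by omega) (by omega) hij.symm
      omega
    · have := hw _ _ (by omega) (by omega) hij
      omega
  · intro i j hi hj hij
    split_ifs at hij with h1 h2 h2
    · exact einj _ _ (by omega) (by omega) hij
    · exact absurd hij (edne _ _ (by omega) (by omega))
    · exact absurd hij.symm (edne _ _ (by omega) (by omega))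
    · have := dinj _ _ (by omega) (by omega) hij
      omega
  · intro i hi
    split_ifs with h1 h2 h2
    · exact he i h1
    · rw [he i h1]
      obtain rfl : i = n := by omega
      rw [hvl, ← hwl]
      congr 3
      omega
    · omega
    · rw [hd _ (by omega), Sym2.eq_swap, show n + m + 2 - i = n + m + 1 - i + 1 by omega,
        show n + m + 2 - (i + 1) = n + m + 1 - i by omega]
  · rw [if_neg (by omega), if_pos (by omega), Nat.sub_self, hw0, hv0]

theorem Joined.symm {S : Set E} {a b : N} (h : G.Joined S a b) : G.Joined S b a := by
  induction h with
  | refl => exact Relation.ReflTransGen.refl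
  | tail _ hbc ih =>
    exact Relation.ReflTransGen.head (hbc.imp fun e h => ⟨h.1, h.2.trans Sym2.eq_swap⟩) ih

theorem Joined.trans {S : Set E} {a b c : N} (h : G.Joined S a b) (h' : G.Joined S b c) :
    G.Joined S a c :=
  Relation.ReflTransGen.trans h h'

theorem Joined.mono {S T : Set E} (hST : S ⊆ T) {a b : N} (h : G.Joined S a b) :
    G.Joined T a b := by
  induction h with
  | refl => exact Relation.ReflTransGen.refl
  | tail _ hbc ih => exact ih.tail (hbc.imp fun e h => ⟨hST h.1, h.2⟩)

theorem Joined.single {S : Set E} {a b : N} {e : E} (he : e ∈ S) (h : G.ends e = s(a, b)) :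
    G.Joined S a b :=
  Relation.ReflTransGen.single ⟨e, he, h⟩

theorem mem_closure_iff {S : Set E} {e : E} {a b : N} (h : G.ends e = s(a, b)) :
    e ∈ G.closure S ↔ G.Joined S a b := by
  refine ⟨fun he => he a b h, fun hj c d hcd => ?_⟩
  rw [h, Sym2.eq_iff] at hcd
  rcases hcd with ⟨rfl, rfl⟩ | ⟨rfl, rfl⟩
  exacts [hj, hj.symm]

theorem IsPath.joined {a b : N} {X : Set N} {P : Set E} (h : G.IsPath a b X P) :
    G.Joined P a b := by
  obtain ⟨n, v, e, -, rfl, rfl, he, rfl, rfl⟩ := h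
  have : ∀ i, G.Joined (Set.range e) (v 0) (v i) := by
    intro i
    induction i using Fin.induction with
    | zero => exact Relation.ReflTransGen.refl
    | succ i ih => exact ih.trans (Joined.single ⟨i, rfl⟩ (he i))
  exact this _

/-- The simple graph of adjacency by the links in an edge set. -/
def adjGraph (G : EGraph N E) (S : Set E) : SimpleGraph N where
  Adj a b := a ≠ b ∧ ∃ e ∈ S, G.ends e = s(a, b)
  symm := ⟨fun _ _ h => ⟨h.1.symm, h.2.imp fun _ he => ⟨he.1, he.2.trans Sym2.eq_swap⟩⟩⟩
  loopless := ⟨fun _ h => h.1 rfl⟩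

theorem Joined.exists_isPath {S : Set E} {a b : N} (h : G.Joined S a b) :
    ∃ X, ∃ P ⊆ S, G.IsPath a b X P := by
  classical
  -- Steps along half edges do not move and are dropped.
  have hr : (G.adjGraph S).Reachable a b := by
    induction h with
    | refl => rfl
    | @tail b c _ hbc ih =>
      by_cases hne : b = c
      · exact hne ▸ ih
      · exact ih.trans (SimpleGraph.Adj.reachable (G := G.adjGraph S) ⟨hne, hbc⟩)
  obtain ⟨p, hp⟩ := hr.exists_isPath
  have hadj : ∀ i : Fin p.length, ∃ e ∈ S, G.ends e = s(p.getVert i, p.getVert (i + 1)) :=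
    fun i => (p.adj_getVert_succ i.2).2
  choose e heS he using hadj
  refine ⟨_, _, ?_, p.length, fun i => p.getVert i, e, ?_, ?_, ?_, ?_, rfl, rfl⟩
  · rintro _ ⟨i, rfl⟩
    exact heS i
  · intro i j hij
    exact Fin.ext (hp.getVert_injOn (Nat.lt_succ_iff.1 i.2) (Nat.lt_succ_iff.1 j.2) hij)
  · simp
  · simp
  · intro i
    exact he i

theorem isPath_of_ends {a b : N} {e : E} (hab : a ≠ b) (h : G.ends e = s(a, b)) :
    G.IsPath a b {a, b} {e} := by
  refine ⟨1, ![a, b], ![e], ?_, rfl, rfl, ?_, ?_, ?_⟩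
  · intro i j
    fin_cases i <;> fin_cases j <;> simp [hab, hab.symm]
  · intro i
    fin_cases i
    simpa using h
  · simp [Set.pair_comm]
  · simp

/-- An edge outside an edge set that joins its endpoints completes a circle. -/
theorem Joined.exists_isCircle {S : Set E} {a b : N} {e : E} (h : G.Joined S a b) (hab : a ≠ b)
    (he : G.ends e = s(a, b)) (heS : e ∉ S) :
    ∃ P ⊆ S, G.Joined P a b ∧ G.IsCircle (insert e P) := by
  obtain ⟨X, P, hPS, hP⟩ := h.exists_isPath
  refine ⟨P, hPS, hP.joined, ?_⟩
  have hX : a ∈ X ∧ b ∈ X := by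
    obtain ⟨n, v, e, -, rfl, rfl, he, rfl, rfl⟩ := hP
    exact ⟨⟨_, rfl⟩, ⟨_, rfl⟩⟩
  rw [Set.insert_eq, Set.union_comm]
  refine hP.isCircle_union (isPath_of_ends hab he) hab ?_
    (Set.disjoint_singleton_right.2 fun h => heS (hPS h))
  rw [Set.inter_eq_right]
  rintro x (rfl | rfl)
  exacts [hX.1, hX.2]

theorem IsClosedPath.node_ne {n : ℕ} {v : Fin (n + 2) → N} {e : Fin (n + 2) → E}
    (h : G.IsClosedPath v e) (i : Fin (n + 2)) : v i ≠ v (i + 1) := fun hv => by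
  have := h.1 hv
  simp at this

theorem IsClosedPath.encard_range {n : ℕ} {v : Fin (n + 2) → N} {e : Fin (n + 2) → E}
    (h : G.IsClosedPath v e) : (Set.range e).encard = n + 2 := by
  rw [← Set.image_univ, h.2.1.encard_image, Set.encard_univ]
  simp

theorem IsCircle.two_le_encard {C : Set E} (h : G.IsCircle C) : 2 ≤ C.encard := by
  obtain ⟨n, v, e, h, rfl⟩ := h
  rw [h.encard_range]
  exact le_add_self

/-! ### Potentials -/

section Potential

variable {H : Type*} [Group H]

/-- `θ` is a potential on the edge set `S` for the gains `g`, where `g a e` is the gain of `e` in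
the direction that leaves `a`. -/
def IsPotential (G : EGraph N E) (g : N → E → H) (S : Set E) (θ : N → H) : Prop :=
  ∀ e ∈ S, ∀ a b, G.ends e = s(a, b) → θ b = g a e * θ a

variable {g : N → E → H}

theorem IsPotential.mono {S T : Set E} {θ : N → H} (h : G.IsPotential g T θ) (hST : S ⊆ T) :
    G.IsPotential g S θ := fun e he => h e (hST he)

/-- Both sides are the gain of any walk in `S` from `a` to `b`. -/
theorem IsPotential.ratio_eq {S : Set E} {θ θ' : N → H} (h : G.IsPotential g S θ)
    (h' : G.IsPotential g S θ') {a b : N} (hj : G.Joined S a b) :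
    θ b * (θ a)⁻¹ = θ' b * (θ' a)⁻¹ := by
  induction hj with
  | refl => simp
  | @tail b c _ hbc ih =>
    obtain ⟨e, he, hbc⟩ := hbc
    rw [h e he b c hbc, h' e he b c hbc, mul_assoc, mul_assoc, ih]

/-- Edges are added one at a time. If the ends of the new edge are already joined, it closes a
circle, whose potential shows that the old potential is right for it. Otherwise the potential is
adjusted on one component. -/
theorem exists_isPotential_finset {S : Set E} (hS : ∀ e ∈ S, ¬ G.IsHalfEdge e)
    (hg : ∀ e a b, G.ends e = s(a, b) → a ≠ b → g b e = (g a e)⁻¹)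
    (hC : ∀ C ⊆ S, G.IsCircle C → ∃ θ, G.IsPotential g C θ) (A : Finset E) :
    (A : Set E) ⊆ S → ∃ θ, G.IsPotential g A θ := by
  classical
  induction A using Finset.induction_on with
  | empty => exact fun _ => ⟨1, by simp [IsPotential]⟩
  | insert e A heA ih =>
    intro hA
    rw [Finset.coe_insert, Set.insert_subset_iff] at hA
    obtain ⟨θ, hθ⟩ := ih hA.2
    obtain ⟨a, b, hab⟩ : ∃ a b, G.ends e = s(a, b) :=
      ⟨_, _, (Quot.out_eq (G.ends e)).symm⟩
    have hne : a ≠ b := fun h => hS e hA.1 (by simp [IsHalfEdge, hab, h])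
    -- it suffices to have a potential on `A` that is right for `e` in one direction
    suffices h : ∃ θ, G.IsPotential g A θ ∧ θ b = g a e * θ a by
      obtain ⟨θ, hθ, hab'⟩ := h
      refine ⟨θ, ?_⟩
      rw [Finset.coe_insert]
      rintro x (rfl | hx) c d hcd
      · rw [hab, Sym2.eq_iff] at hcd
        rcases hcd with ⟨rfl, rfl⟩ | ⟨rfl, rfl⟩
        · exact hab'
        · rw [hg x a b hab hne, hab', inv_mul_cancel_left]
      · exact hθ x hx c d hcd
    by_cases hj : G.Joined A a b
    · obtain ⟨P, hPA, hP, hcirc⟩ := hj.exists_isCircle hne hab (by simpa using heA)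
      obtain ⟨θ', hθ'⟩ := hC _ (Set.insert_subset hA.1 (hPA.trans hA.2)) hcirc
      refine ⟨θ, hθ, ?_⟩
      have h1 := (hθ.mono hPA).ratio_eq (hθ'.mono (Set.subset_insert _ _)) hP
      rw [hθ' e (Set.mem_insert _ _) a b hab, mul_inv_cancel_right] at h1
      rw [← h1, inv_mul_cancel_right]
    -- Gains act on the left, so right multiplication by a constant on the component of `b`
    -- preserves potentials; this constant gives `b` the value `g a e * θ a`.
    · refine ⟨fun x => if G.Joined A b x then θ x * ((θ b)⁻¹ * g a e * θ a) else θ x, ?_, ?_⟩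
      · intro x hx c d hcd
        have hiff : G.Joined A b d ↔ G.Joined A b c :=
          ⟨fun h => h.trans (Joined.single hx hcd).symm, fun h => h.trans (Joined.single hx hcd)⟩
        simp only [hiff, hθ x hx c d hcd]
        split_ifs
        · rw [mul_assoc]
        · rfl
      · have h1 : ¬ G.Joined A b a := fun h => hj h.symm
        have h2 : G.Joined A b b := Relation.ReflTransGen.refl
        simp only [h1, h2, if_true, if_false]
        group

/-- If all circles in an edge set have potentials, then so does the set. -/
theorem exists_isPotential {S : Set E} (hS : ∀ e ∈ S, ¬ G.IsHalfEdge e)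
    (hg : ∀ e a b, G.ends e = s(a, b) → a ≠ b → g b e = (g a e)⁻¹)
    (hC : ∀ C ⊆ S, G.IsCircle C → ∃ θ, G.IsPotential g C θ) : ∃ θ, G.IsPotential g S θ := by
  classical
  have hfin := exists_isPotential_finset hS hg hC
  -- the gain of walks between two nodes is well defined
  let R : N → N → H → Prop := fun a b t => ∃ A : Finset E, (A : Set E) ⊆ S ∧ G.Joined A a b ∧
    ∀ θ, G.IsPotential g A θ → θ b = t * θ a
  have hex : ∀ a b, G.Joined S a b → ∃ t, R a b t := by
    intro a b hab
    induction hab with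
    | refl => exact ⟨1, ∅, by simp, Relation.ReflTransGen.refl, fun θ _ => (one_mul _).symm⟩
    | @tail b c _ hbc ih =>
      obtain ⟨t, A, hA, hj, ht⟩ := ih
      obtain ⟨e, he, hbc⟩ := hbc
      refine ⟨g b e * t, insert e A, ?_, ?_, ?_⟩
      · rw [Finset.coe_insert]
        exact Set.insert_subset he hA
      · rw [Finset.coe_insert]
        exact (hj.mono (Set.subset_insert _ _)).trans (Joined.single (Set.mem_insert _ _) hbc)
      · intro θ hθ
        rw [Finset.coe_insert] at hθ
        rw [hθ e (Set.mem_insert _ _) b c hbc, ht θ (hθ.mono (Set.subset_insert _ _)), mul_assoc]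
  -- Two finite witnesses and the edge `e` lie in one finite set, and a potential on that set
  -- compares them.
  have huniq : ∀ a b t e c, e ∈ S → G.ends e = s(b, c) → R a b t → ∀ t', R a c t' →
      t' = g b e * t := by
    rintro a b t e c he hbc ⟨A, hA, -, ht⟩ t' ⟨A', hA', -, ht'⟩
    obtain ⟨θ, hθ⟩ := hfin (insert e (A ∪ A')) (by
      rw [Finset.coe_insert, Finset.coe_union]
      exact Set.insert_subset he (Set.union_subset hA hA'))
    have h1 := ht θ (hθ.mono fun x hx => by
      simp only [Finset.mem_coe] at hx; simp [hx])
    have h2 := ht' θ (hθ.mono fun x hx => by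
      simp only [Finset.mem_coe] at hx; simp [hx])
    have h3 := hθ e (by simp) b c hbc
    rw [h1, h2, ← mul_assoc] at h3
    exact mul_right_cancel h3
  -- The potential at a node is the gain of the walks to it from a chosen representative of its
  -- component.
  let s : Setoid N := ⟨G.Joined S, fun _ => Relation.ReflTransGen.refl, Joined.symm, Joined.trans⟩
  have hout : ∀ b, G.Joined S (Quotient.mk s b).out b := fun b => Quotient.mk_out (s := s) b
  choose t ht using fun b => hex _ b (hout b)
  refine ⟨t, fun e he b c hbc => ?_⟩
  have hq : Quotient.mk s b = Quotient.mk s c := Quotient.sound (Joined.single he hbc)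
  have htc := ht c
  rw [← hq] at htc
  exact huniq _ b (t b) e c he hbc (ht b) _ htc

end Potential

end EGraph
end OrthoLift

namespace OrthoLift

/-! ### Vectors of graphic matroids -/

section Graphic

variable {N E F : Type*} [DivisionRing F]

variable (F) in
/-- The vector `b - a` of a link from `a` to `b`. -/
noncomputable def diffVec (a b : N) : N →₀ F := Finsupp.single b 1 - Finsupp.single a 1

theorem neg_diffVec (a b : N) : -diffVec F a b = diffVec F b a := neg_sub _ _

theorem diffVec_self (a : N) : diffVec F a a = 0 := sub_self _

theorem diffVec_add (a b c : N) : diffVec F a b + diffVec F b c = diffVec F a c := by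
  rw [diffVec, diffVec, diffVec, add_comm, sub_add_sub_cancel]

theorem linearCombination_diffVec (θ : N → F) (a b : N) :
    Finsupp.linearCombination F θ (diffVec F a b) = θ b - θ a := by
  simp [diffVec]

theorem diffVec_apply_right {a b : N} (h : a ≠ b) : diffVec F a b b = 1 := by
  simp [diffVec, h]

theorem diffVec_apply_of_ne {a b x : N} (ha : x ≠ a) (hb : x ≠ b) : diffVec F a b x = 0 := by
  simp [diffVec, ha.symm, hb.symm]

theorem diffVec_ne_zero {a b : N} (h : a ≠ b) : diffVec F a b ≠ 0 := fun h0 => by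
  have := diffVec_apply_right (F := F) h
  rw [h0] at this
  simp at this

open Classical in
/-- The linear form on `F ^ N` that sums the coordinates at the nodes that `S` joins to `a`. -/
noncomputable def componentForm (F : Type*) [DivisionRing F] (G : EGraph N E) (S : Set E) (a : N) :
    (N →₀ F) →ₗ[F] F :=
  Finsupp.linearCombination F fun x => if G.Joined S a x then (1 : F) else 0

theorem componentForm_diffVec_of_mem {G : EGraph N E} {S : Set E} (a : N) {e : E} (he : e ∈ S)
    {x y : N} (h : G.ends e = s(x, y)) : componentForm F G S a (diffVec F x y) = 0 := by
  have hiff : G.Joined S a y ↔ G.Joined S a x :=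
    ⟨fun hj => hj.trans (EGraph.Joined.single he h).symm,
      fun hj => hj.trans (EGraph.Joined.single he h)⟩
  rw [componentForm, linearCombination_diffVec, sub_eq_zero]
  classical exact if_congr hiff rfl rfl

theorem componentForm_diffVec_of_not_joined {G : EGraph N E} {S : Set E} {a b : N}
    (h : ¬ G.Joined S a b) : componentForm F G S a (diffVec F a b) = -1 := by
  have h' : G.Joined S a a := Relation.ReflTransGen.refl
  rw [componentForm, linearCombination_diffVec]
  simp [h, h']

end Graphic

/-! ### Additive gain graphs and the analytic representation. -/

namespace GainGraph

theorem ends_graph {N E F : Type*} (Φ : GainGraph N E F) (e : E) : Φ.graph.ends e = s(Φ.tail e, Φ.head e) := rfl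

variable {N E F : Type*} [DivisionRing F] (Φ : GainGraph N E F)

theorem isHalfEdge_iff (e : E) : Φ.biased.IsHalfEdge e ↔ Φ.tail e = Φ.head e := by
  simp [EGraph.IsHalfEdge, biased, graph]

variable {Φ}

theorem liftVec_some {e : E} (h : Φ.tail e ≠ Φ.head e) :
    Φ.liftVec (some e) = (Φ.gain e, diffVec F (Φ.tail e) (Φ.head e)) := by
  simp [liftVec, h, diffVec]

theorem ends_eq_iff {e : E} {a b : N} (h : Φ.graph.ends e = s(a, b)) (hab : a ≠ b) :
    (a = Φ.tail e ∧ b = Φ.head e ∧ Φ.gainFrom a e = Φ.gain e) ∨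
      (a = Φ.head e ∧ b = Φ.tail e ∧ Φ.gainFrom a e = -Φ.gain e) := by
  rw [ends_graph, Sym2.eq_iff] at h
  rcases h with ⟨rfl, rfl⟩ | ⟨rfl, rfl⟩
  · simp [gainFrom]
  · simp [gainFrom, hab]

theorem tail_ne_head {e : E} {a b : N} (h : Φ.graph.ends e = s(a, b)) (hab : a ≠ b) :
    Φ.tail e ≠ Φ.head e := by
  rcases ends_eq_iff h hab with ⟨rfl, rfl, -⟩ | ⟨rfl, rfl, -⟩
  exacts [hab, hab.symm]

theorem gainFrom_swap {e : E} {a b : N} (h : Φ.graph.ends e = s(a, b)) (hab : a ≠ b) :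
    Φ.gainFrom b e = -Φ.gainFrom a e := by
  rcases ends_eq_iff h hab with ⟨h1, h2, h3⟩ | ⟨h1, h2, h3⟩ <;>
  rcases ends_eq_iff (h.trans Sym2.eq_swap) hab.symm with ⟨h4, h5, h6⟩ | ⟨h4, h5, h6⟩
  · exact absurd (h1.trans h4.symm) hab
  · rw [h3, h6]
  · rw [h3, h6, neg_neg]
  · exact absurd (h1.trans h4.symm) hab

theorem liftVec_of_ends {e : E} {a b : N} (h : Φ.graph.ends e = s(a, b)) (hab : a ≠ b) :
    Φ.liftVec (some e) = (Φ.gainFrom a e, diffVec F a b) ∨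
      Φ.liftVec (some e) = -(Φ.gainFrom a e, diffVec F a b) := by
  rw [liftVec_some (tail_ne_head h hab)]
  rcases ends_eq_iff h hab with ⟨rfl, rfl, h3⟩ | ⟨rfl, rfl, h3⟩
  · exact Or.inl (by rw [h3])
  · exact Or.inr (by rw [h3, Prod.neg_mk, neg_neg, neg_diffVec])

/-- Reversing an edge only changes the sign of its vector, so subspaces do not see the orientation.
-/
theorem liftVec_mem_iff {e : E} {a b : N} (h : Φ.graph.ends e = s(a, b)) (hab : a ≠ b)
    (M : Submodule F (F × (N →₀ F))) :
    Φ.liftVec (some e) ∈ M ↔ (Φ.gainFrom a e, diffVec F a b) ∈ M := by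
  rcases liftVec_of_ends h hab with h | h <;> rw [h]
  exact M.neg_mem_iff

variable (Φ) in
/-- `θ` is an additive potential on the edge set `S`. -/
def HasPotential (S : Set E) (θ : N → F) : Prop :=
  ∀ e ∈ S, Φ.gain e = θ (Φ.head e) - θ (Φ.tail e)

theorem HasPotential.mono {S T : Set E} {θ : N → F} (h : Φ.HasPotential T θ) (hST : S ⊆ T) :
    Φ.HasPotential S θ := fun e he => h e (hST he)

theorem gain_eq_iff {e : E} {a b : N} (h : Φ.graph.ends e = s(a, b)) (hab : a ≠ b) (θ : N → F) :
    Φ.gain e = θ (Φ.head e) - θ (Φ.tail e) ↔ θ b = Φ.gainFrom a e + θ a := by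
  rcases ends_eq_iff h hab with ⟨rfl, rfl, h3⟩ | ⟨rfl, rfl, h3⟩ <;> rw [h3]
  · rw [eq_sub_iff_add_eq, eq_comm]
  · rw [eq_sub_iff_add_eq, eq_neg_add_iff_add_eq]

theorem HasPotential.isPotential {S : Set E} {θ : N → F} (h : Φ.HasPotential S θ)
    (hS : ∀ e ∈ S, Φ.tail e ≠ Φ.head e) :
    Φ.graph.IsPotential (fun a e => Multiplicative.ofAdd (Φ.gainFrom a e)) S
      (fun x => Multiplicative.ofAdd (θ x)) := by
  intro e he a b hab
  have hne : a ≠ b := by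
    rintro rfl
    apply hS e he
    rw [ends_graph, Sym2.eq_iff] at hab
    rcases hab with ⟨h1, h2⟩ | ⟨h1, h2⟩ <;> rw [h1, h2]
  exact congrArg Multiplicative.ofAdd ((gain_eq_iff hab hne θ).1 (h e he))

theorem exists_cyclic_potential_iff {n : ℕ} (g : Fin (n + 2) → F) :
    ∑ i, g i = 0 ↔ ∃ θ : Fin (n + 2) → F, ∀ i, θ (i + 1) = g i + θ i := by
  constructor
  · intro h
    -- Partial sums satisfy the recursion; the total `0` closes it at the last index.
    let σ : ℕ → F := fun k => ∑ j ∈ Finset.range k, if hj : j < n + 2 then g ⟨j, hj⟩ else 0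
    have hσ : ∀ i : Fin (n + 2), σ (i + 1) = g i + σ i := fun i => by
      simp only [σ]
      rw [Finset.sum_range_succ, dif_pos i.2, add_comm]
    have hσl : σ (n + 2) = 0 := by
      rw [← h, Finset.sum_fin_eq_sum_range]
    refine ⟨fun i => σ i, fun i => ?_⟩
    change σ (i + 1 : Fin (n + 2)) = _
    rw [← hσ i]
    rcases Nat.lt_or_ge (i.1 + 1) (n + 2) with hi | hi
    · rw [Fin.val_add_one_of_lt' hi]
    · have : i = Fin.last (n + 1) := Fin.ext (by simp; omega)
      rw [this, Fin.last_add_one]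
      exact hσl.symm
  · rintro ⟨θ, hθ⟩
    have h1 : ∑ i, θ (i + 1) = ∑ i, θ i := Equiv.sum_comp (Equiv.addRight (1 : Fin (n + 2))) θ
    simp only [hθ, Finset.sum_add_distrib] at h1
    simpa using h1

theorem sum_gainFrom_eq_zero_iff {n : ℕ} {v : Fin (n + 2) → N} {e : Fin (n + 2) → E}
    (h : Φ.graph.IsClosedPath v e) :
    ∑ i, Φ.gainFrom (v i) (e i) = 0 ↔ ∃ θ, Φ.HasPotential (Set.range e) θ := by
  rw [exists_cyclic_potential_iff]
  constructor
  · rintro ⟨θ, hθ⟩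
    refine ⟨Function.extend v θ 0, ?_⟩
    rintro _ ⟨i, rfl⟩
    rw [gain_eq_iff (h.2.2 i) (h.node_ne i), h.1.extend_apply, h.1.extend_apply, hθ]
  · rintro ⟨θ, hθ⟩
    exact ⟨fun i => θ (v i), fun i =>
      (gain_eq_iff (h.2.2 i) (h.node_ne i) θ).1 (hθ _ ⟨i, rfl⟩)⟩

/-- This frees balance from the choice of a closed path around the circle. -/
theorem mem_balanced_iff {C : Set E} :
    C ∈ Φ.biased.balanced ↔ Φ.graph.IsCircle C ∧ ∃ θ, Φ.HasPotential C θ := by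
  constructor
  · rintro ⟨n, v, e, h, rfl, hs⟩
    exact ⟨⟨n, v, e, h, rfl⟩, (sum_gainFrom_eq_zero_iff h).1 hs⟩
  · rintro ⟨⟨n, v, e, h, rfl⟩, hθ⟩
    exact ⟨n, v, e, h, rfl, (sum_gainFrom_eq_zero_iff h).2 hθ⟩

/-- The linear form that vanishes on the vectors of the edges on which `θ` is a potential. -/
noncomputable def potentialForm (θ : N → F) : F × (N →₀ F) →ₗ[F] F :=
  LinearMap.fst F F (N →₀ F) - (Finsupp.linearCombination F θ).comp (LinearMap.snd F F (N →₀ F))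

theorem potentialForm_mk (θ : N → F) (x : F) (a b : N) :
    potentialForm θ (x, diffVec F a b) = x - (θ b - θ a) := by
  simp [potentialForm, linearCombination_diffVec]

theorem potentialForm_none (θ : N → F) : potentialForm θ (Φ.liftVec none) = 1 := by
  simp [potentialForm, liftVec]

theorem potentialForm_some {θ : N → F} {e : E} (h : Φ.tail e ≠ Φ.head e) :
    potentialForm θ (Φ.liftVec (some e)) = 0 ↔ Φ.gain e = θ (Φ.head e) - θ (Φ.tail e) := by
  rw [liftVec_some h, potentialForm_mk, sub_eq_zero]

theorem potentialForm_eq_zero {θ : N → F} {S : Set E} (hS : ∀ e ∈ S, Φ.tail e ≠ Φ.head e)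
    (h : Φ.HasPotential S θ) {x : F × (N →₀ F)}
    (hx : x ∈ Submodule.span F (Φ.liftVec '' (some '' S))) : potentialForm θ x = 0 := by
  have : Submodule.span F (Φ.liftVec '' (some '' S)) ≤ LinearMap.ker (potentialForm θ) := by
    rw [Submodule.span_le]
    rintro _ ⟨_, ⟨e, he, rfl⟩, rfl⟩
    exact (potentialForm_some (hS e he)).2 (h e he)
  exact this hx

theorem none_not_mem_span {θ : N → F} {S : Set E} (hS : ∀ e ∈ S, Φ.tail e ≠ Φ.head e)
    (h : Φ.HasPotential S θ) :
    Φ.liftVec none ∉ Submodule.span F (Φ.liftVec '' (some '' S)) := fun hx => by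
  have := potentialForm_eq_zero hS h hx
  rw [potentialForm_none] at this
  exact one_ne_zero this

theorem tail_ne_head_of_isCircle {C : Set E} (hC : Φ.graph.IsCircle C) :
    ∀ e ∈ C, Φ.tail e ≠ Φ.head e := by
  obtain ⟨n, v, e, h, rfl⟩ := hC
  rintro _ ⟨i, rfl⟩
  exact tail_ne_head (h.2.2 i) (h.node_ne i)

/-- The node differences telescope around the circle. -/
theorem sum_closedPath {n : ℕ} {v : Fin (n + 2) → N} (g : Fin (n + 2) → F) :
    ∑ i, (g i, diffVec F (v i) (v (i + 1))) = (∑ i, g i, 0) := by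
  refine Prod.ext (by simp [Prod.fst_sum]) ?_
  rw [Prod.snd_sum]
  simp only [diffVec, Finset.sum_sub_distrib]
  rw [sub_eq_zero]
  exact Equiv.sum_comp (Equiv.addRight (1 : Fin (n + 2))) fun i => Finsupp.single (v i) (1 : F)

/-- An unbalanced circle spans `(1, 0)`. -/
theorem none_mem_span_of_not_balanced {C : Set E} (hC : Φ.graph.IsCircle C)
    (h : C ∉ Φ.biased.balanced) :
    Φ.liftVec none ∈ Submodule.span F (Φ.liftVec '' (some '' C)) := by
  obtain ⟨n, v, e, hc, rfl⟩ := hC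
  have hg : ∑ i, Φ.gainFrom (v i) (e i) ≠ 0 := fun h0 => h ⟨n, v, e, hc, rfl, h0⟩
  have hm : (∑ i, Φ.gainFrom (v i) (e i), (0 : N →₀ F)) ∈
      Submodule.span F (Φ.liftVec '' (some '' Set.range e)) := by
    rw [← sum_closedPath (v := v)]
    refine Submodule.sum_mem _ fun i _ => ?_
    rw [← liftVec_mem_iff (hc.2.2 i) (hc.node_ne i)]
    exact Submodule.subset_span ⟨_, ⟨_, ⟨i, rfl⟩, rfl⟩, rfl⟩
  have := Submodule.smul_mem _ (∑ i, Φ.gainFrom (v i) (e i))⁻¹ hm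
  simpa [liftVec, hg] using this

/-- A circle is balanced if and only if it does not span `(1, 0)`. -/
theorem mem_balanced_iff_not_mem_span {C : Set E} (hC : Φ.graph.IsCircle C) :
    C ∈ Φ.biased.balanced ↔
      Φ.liftVec none ∉ Submodule.span F (Φ.liftVec '' (some '' C)) := by
  constructor
  · intro h
    obtain ⟨θ, hθ⟩ := (mem_balanced_iff.1 h).2
    exact none_not_mem_span (tail_ne_head_of_isCircle hC) hθ
  · intro h
    by_contra hb
    exact h (none_mem_span_of_not_balanced hC hb)

/-- In a balanced circle each edge is in the span of the others. -/
theorem mem_span_of_balanced {C S : Set E} (hC : C ∈ Φ.biased.balanced) {e : E} (he : e ∈ C)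
    (h : C ⊆ insert e S) :
    Φ.liftVec (some e) ∈ Submodule.span F (Φ.liftVec '' (some '' S)) := by
  obtain ⟨n, v, d, hc, rfl, hs⟩ := hC
  obtain ⟨i, rfl⟩ := he
  have h0 := sum_closedPath (v := v) fun i => Φ.gainFrom (v i) (d i)
  rw [hs, Prod.mk_zero_zero, ← Finset.add_sum_erase _ _ (Finset.mem_univ i)] at h0
  rw [liftVec_mem_iff (hc.2.2 i) (hc.node_ne i), eq_neg_of_add_eq_zero_left h0]
  refine Submodule.neg_mem _ (Submodule.sum_mem _ fun j hj => ?_)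
  rw [← liftVec_mem_iff (hc.2.2 j) (hc.node_ne j)]
  refine Submodule.subset_span ⟨_, ⟨_, ?_, rfl⟩, rfl⟩
  rcases h ⟨j, rfl⟩ with h | h
  · exact absurd (hc.2.1 h) (Finset.ne_of_mem_erase hj)
  · exact h

theorem exists_hasPotential {S : Set E} (hS : Φ.biased.IsBalancedSet S) :
    ∃ θ, Φ.HasPotential S θ := by
  obtain ⟨θ, hθ⟩ := EGraph.exists_isPotential (G := Φ.graph) (H := Multiplicative F)
    (g := fun a e => Multiplicative.ofAdd (Φ.gainFrom a e)) (S := S) hS.1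
    (fun e a b h hab => by rw [gainFrom_swap h hab, ofAdd_neg])
    (fun C hCS hC => by
      obtain ⟨θ, hθ⟩ := (mem_balanced_iff.1 (hS.2 C hCS hC)).2
      exact ⟨_, hθ.isPotential (tail_ne_head_of_isCircle hC)⟩)
  refine ⟨fun x => (θ x).toAdd, fun e he => ?_⟩
  have hne : Φ.tail e ≠ Φ.head e := fun h => hS.1 e he ((Φ.isHalfEdge_iff e).2 h)
  apply (gain_eq_iff (Φ.ends_graph e) hne _).2
  exact congrArg Multiplicative.toAdd (hθ e he _ _ (Φ.ends_graph e))

/-- Edges in the span of an edge set and `(1, 0)` are in the graphic closure. -/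
theorem joined_of_mem_span (hΦ : ∀ e, Φ.tail e ≠ Φ.head e) {S : Set (Option E)} {e : E}
    (h : Φ.liftVec (some e) ∈ Submodule.span F (Φ.liftVec '' S)) :
    Φ.graph.Joined (some ⁻¹' S) (Φ.tail e) (Φ.head e) := by
  by_contra hj
  -- The sum of the node coordinates over the component of the tail kills `(1, 0)` and every edge of
  -- `S`, but is `-1` at `e`.
  have hle : Submodule.span F (Φ.liftVec '' S) ≤ LinearMap.ker
      ((componentForm F Φ.graph (some ⁻¹' S) (Φ.tail e)).comp (LinearMap.snd F F (N →₀ F))) := by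
    rw [Submodule.span_le]
    rintro _ ⟨x, hx, rfl⟩
    rcases x with _ | d
    · simp [liftVec]
    · rw [SetLike.mem_coe, LinearMap.mem_ker, LinearMap.comp_apply, liftVec_some (hΦ d)]
      exact componentForm_diffVec_of_mem _ (S := some ⁻¹' S) hx (Φ.ends_graph d)
  have h1 := hle h
  rw [LinearMap.mem_ker, LinearMap.comp_apply, liftVec_some (hΦ e), LinearMap.snd_apply,
    componentForm_diffVec_of_not_joined hj] at h1
  exact neg_ne_zero.2 one_ne_zero h1

/-- Node differences add up along a walk, and multiples of `(1, 0)` correct the first coordinate. -/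
theorem mem_span_of_joined {S : Set (Option E)}
    (hn : Φ.liftVec none ∈ Submodule.span F (Φ.liftVec '' S)) {a b : N}
    (h : Φ.graph.Joined (some ⁻¹' S) a b) (x : F) :
    (x, diffVec F a b) ∈ Submodule.span F (Φ.liftVec '' S) := by
  have hx : ∀ x : F, (x, (0 : N →₀ F)) ∈ Submodule.span F (Φ.liftVec '' S) := fun x => by
    simpa [liftVec] using Submodule.smul_mem _ x hn
  induction h generalizing x with
  | refl => rw [diffVec_self]; exact hx x
  | @tail b c _ hbc ih =>
    obtain ⟨e, he, hbc⟩ := hbc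
    by_cases hne : b = c
    · exact hne ▸ ih x
    · have h1 : Φ.liftVec (some e) ∈ Submodule.span F (Φ.liftVec '' S) :=
        Submodule.subset_span ⟨_, he, rfl⟩
      rw [liftVec_mem_iff hbc hne] at h1
      simpa [diffVec_add] using Submodule.add_mem _ (ih (x - Φ.gainFrom b e)) h1

/-- The analytic orthographic representation represents the extended lift matroid. -/
theorem mem_liftClosure_iff (hΦ : ∀ e, Φ.tail e ≠ Φ.head e) (S : Set (Option E)) (x : Option E) :
    x ∈ Φ.biased.liftClosure S ↔ Φ.liftVec x ∈ Submodule.span F (Φ.liftVec '' S) := by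
  have hhalf : ∀ e, ¬ Φ.biased.IsHalfEdge e := fun e h => hΦ e ((Φ.isHalfEdge_iff e).1 h)
  rw [CircleGraph.liftClosure]
  split_ifs with h
  · obtain ⟨hn, hS⟩ := h
    obtain ⟨θ, hθ⟩ := exists_hasPotential hS
    have hS' : some '' (some ⁻¹' S) = S := by
      rw [Set.image_preimage_eq_iff]
      rintro (_ | e) he
      · exact absurd he hn
      · exact ⟨e, rfl⟩
    rcases x with _ | e
    · have h1 := none_not_mem_span (fun e _ => hΦ e) hθ
      rw [hS'] at h1
      simp [h1]
    · simp only [Set.mem_image, Option.some.injEq, exists_eq_right, CircleGraph.balanceClosure]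
      constructor
      · rintro (he | ⟨C, hC, heC, hCS⟩)
        · exact Submodule.subset_span ⟨_, he, rfl⟩
        · have := mem_span_of_balanced hC heC hCS
          rwa [hS'] at this
      · intro he
        by_cases heS : e ∈ some ⁻¹' S
        · exact Or.inl heS
        · right
          obtain ⟨P, hPS, -, hC⟩ := (joined_of_mem_span hΦ he).exists_isCircle (hΦ e)
            (Φ.ends_graph e) heS
          refine ⟨_, mem_balanced_iff.2 ⟨hC, θ, ?_⟩, Set.mem_insert _ _,
            Set.insert_subset_insert hPS⟩
          -- The form of `θ` vanishes on the span of `S`, hence at the new edge, so `θ` is right for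
          -- it too.
          rintro d (rfl | hd)
          · rw [← potentialForm_some (hΦ d)]
            rw [← hS'] at he
            exact potentialForm_eq_zero (fun e _ => hΦ e) hθ he
          · exact hθ d (hPS hd)
  · have hn : Φ.liftVec none ∈ Submodule.span F (Φ.liftVec '' S) := by
      by_cases hn : none ∈ S
      · exact Submodule.subset_span ⟨_, hn, rfl⟩
      -- Without half edges, only an unbalanced circle can make the set unbalanced.
      · have : ∃ C ⊆ some ⁻¹' S, Φ.graph.IsCircle C ∧ C ∉ Φ.biased.balanced := by
          by_contra hb
          push Not at hb
          exact h ⟨hn, fun e _ => hhalf e, hb⟩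
        obtain ⟨C, hCS, hC, hb⟩ := this
        exact Submodule.span_mono (Set.image_mono (Set.image_subset_iff.2 hCS))
          (none_mem_span_of_not_balanced hC hb)
    rcases x with _ | e
    · simp [hn]
    · simp only [Set.mem_insert_iff, Set.mem_image, Option.some.injEq, exists_eq_right, reduceCtorEq,
        false_or]
      refine (EGraph.mem_closure_iff (Φ.ends_graph e)).trans ⟨fun hj => ?_, joined_of_mem_span hΦ⟩
      rw [liftVec_some (hΦ e)]
      exact mem_span_of_joined hn hj _

/-- The balanced circles of a gain graph form a linear class. -/
theorem isBiasedGraph (Φ : GainGraph N E F) : Φ.biased.IsBiasedGraph := by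
  rintro P Q R ⟨a, b, X, Y, Z, hab, hP, hQ, hR, hXY, hYZ, hXZ, hPQ, hQR, hPR⟩ h1 h2
  obtain ⟨θ₁, hθ₁⟩ := (mem_balanced_iff.1 h1).2
  obtain ⟨θ₂, hθ₂⟩ := (mem_balanced_iff.1 h2).2
  have hl : ∀ e ∈ P ∪ Q ∪ R, Φ.tail e ≠ Φ.head e := by
    rintro e (he | he)
    · exact tail_ne_head_of_isCircle (mem_balanced_iff.1 h1).1 e he
    · exact tail_ne_head_of_isCircle (mem_balanced_iff.1 h2).1 e (Or.inr he)
  have hr : ∀ θ θ' : N → F, Φ.HasPotential Q θ → Φ.HasPotential Q θ' →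
      θ b - θ a = θ' b - θ' a := by
    intro θ θ' h h'
    have hQl : ∀ e ∈ Q, Φ.tail e ≠ Φ.head e := fun e he => hl e (Or.inl (Or.inr he))
    simpa [sub_eq_add_neg] using congrArg Multiplicative.toAdd
      ((h.isPotential hQl).ratio_eq (h'.isPotential hQl) (EGraph.IsPath.joined (G := Φ.graph) hQ))
  have hb := hr _ _ (hθ₁.mono Set.subset_union_right) (hθ₂.mono Set.subset_union_left)
  have hends : ∀ (X : Set N) (P : Set E), Φ.graph.IsPath a b X P → ∀ e ∈ P,
      Φ.tail e ∈ X ∧ Φ.head e ∈ X := by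
    rintro X P ⟨n, v, e, -, -, -, he, rfl, rfl⟩ _ ⟨i, rfl⟩
    have := he i
    rw [ends_graph, Sym2.eq_iff] at this
    rcases this with ⟨h1, h2⟩ | ⟨h1, h2⟩ <;> rw [h1, h2]
    exacts [⟨⟨_, rfl⟩, ⟨_, rfl⟩⟩, ⟨⟨_, rfl⟩, ⟨_, rfl⟩⟩]
  classical
  -- `θ₂` is shifted to agree with `θ₁` at `a`. They then agree at `b`, as both have the same
  -- difference along `Q`, and can be glued on `P ∪ R`.
  let θ : N → F := fun x => if x ∈ Z then θ₂ x - θ₂ a + θ₁ a else θ₁ x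
  have hθZ : ∀ x ∈ Z, θ x = θ₂ x - θ₂ a + θ₁ a := fun x hx => if_pos hx
  have hθX : ∀ x ∈ X, θ x = θ₁ x := by
    intro x hx
    by_cases hz : x ∈ Z
    · rw [hθZ x hz]
      have : x ∈ ({a, b} : Set N) := hXZ ▸ ⟨hx, hz⟩
      rcases this with rfl | rfl
      · simp
      · rw [← hb, sub_add_cancel]
    · exact if_neg hz
  refine mem_balanced_iff.2 ⟨EGraph.IsPath.isCircle_union (G := Φ.graph) hP hR hab hXZ hPR, θ, ?_⟩
  rintro e (he | he)
  · obtain ⟨ht, hh⟩ := hends X P hP e he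
    rw [hθX _ ht, hθX _ hh]
    exact hθ₁ e (Or.inl he)
  · obtain ⟨ht, hh⟩ := hends Z R hR e he
    rw [hθZ _ ht, hθZ _ hh, add_sub_add_right_eq_sub, sub_sub_sub_cancel_right]
    exact hθ₂ e (Or.inr he)

end GainGraph

end OrthoLift

namespace OrthoLift

/-! ### Flats and linear maps -/

section Flats

variable {F V W α : Type*} [DivisionRing F] [AddCommGroup V] [Module F V] [AddCommGroup W]
  [Module F W]

theorem submodule_le_iff {p : ℙ F V} {M : Submodule F V} : p.submodule ≤ M ↔ p.rep ∈ M := by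
  rw [Projectivization.submodule_eq, Submodule.span_singleton_le_iff_mem]

theorem flatSpan_eq_span (S : Set (ℙ F V)) :
    flatSpan S = Submodule.span F (Projectivization.rep '' S) := by
  simp only [flatSpan, Projectivization.submodule_eq, ← Submodule.span_iUnion,
    ← Set.image_eq_iUnion]

theorem flatSpan_image (z : α → ℙ F V) (S : Set α) :
    flatSpan (z '' S) = Submodule.span F ((fun x => (z x).rep) '' S) := by
  rw [flatSpan_eq_span, Set.image_image]

theorem submodule_le_flatSpan {S : Set (ℙ F V)} {p : ℙ F V} (hp : p ∈ S) :
    p.submodule ≤ flatSpan S := le_iSup₂_of_le p hp le_rfl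

theorem eq_of_submodule_le {p q : ℙ F V} (h : p.submodule ≤ q.submodule) : p = q := by
  rw [submodule_le_iff, Projectivization.submodule_eq, Submodule.mem_span_singleton] at h
  rw [← p.mk_rep, ← q.mk_rep, Projectivization.mk_eq_mk_iff']
  exact h

theorem map_le_map_iff_of_injOn {T : V →ₗ[F] W} {M A B : Submodule F V}
    (hT : Set.InjOn T (M : Set V)) (hA : A ≤ M) (hB : B ≤ M) : A.map T ≤ B.map T ↔ A ≤ B := by
  refine ⟨fun h x hx => ?_, Submodule.map_mono⟩
  obtain ⟨y, hy, hxy⟩ := h ⟨x, hx, rfl⟩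
  rwa [← hT (hB hy) (hA hx) hxy]

theorem map_flatSpan {T : V →ₗ[F] W} {z : α → ℙ F V} {u : α → W}
    (h : ∀ x, (z x).submodule.map T = Submodule.span F {u x}) (S : Set α) :
    (flatSpan (z '' S)).map T = Submodule.span F (u '' S) := by
  rw [flatSpan, iSup_image]
  simp only [Submodule.map_iSup, h, ← Submodule.span_iUnion, ← Set.image_eq_iUnion]

/-- The transfer principle for both directions: `T` need only be injective on a subspace that
contains all the points. -/
theorem le_flatSpan_iff_mem_span {T : V →ₗ[F] W} {z : α → ℙ F V} {u : α → W} {M : Submodule F V}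
    (hT : Set.InjOn T (M : Set V)) (hz : ∀ x, (z x).submodule ≤ M)
    (h : ∀ x, (z x).submodule.map T = Submodule.span F {u x}) (S : Set α) (x : α) :
    (z x).submodule ≤ flatSpan (z '' S) ↔ u x ∈ Submodule.span F (u '' S) := by
  have hS : flatSpan (z '' S) ≤ M := by
    refine iSup₂_le ?_
    rintro _ ⟨y, -, rfl⟩
    exact hz y
  rw [← map_le_map_iff_of_injOn hT (hz x) hS, h, map_flatSpan h,
    Submodule.span_singleton_le_iff_mem]

theorem map_submodule_eq {T : V →ₗ[F] W} (p : ℙ F V) :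
    p.submodule.map T = Submodule.span F {T p.rep} := by
  rw [Projectivization.submodule_eq, Submodule.map_span, Set.image_singleton]

end Flats

/-! ### Representations of graphic matroids -/

section Unique

variable {F V N : Type*} [DivisionRing F] [AddCommGroup V] [Module F V] {Δ : SimpleGraph N}
  {z : Δ.edgeSet → ℙ F V}

theorem exists_ends (d : Δ.edgeSet) : ∃ a b, a ≠ b ∧ (ofSimple Δ).ends d = s(a, b) := by
  obtain ⟨d, hd⟩ := d
  induction d with
  | h a b => exact ⟨a, b, Δ.ne_of_adj hd, rfl⟩

theorem ne_of_ends {d : Δ.edgeSet} {a b : N} (h : (ofSimple Δ).ends d = s(a, b)) : a ≠ b := by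
  obtain ⟨d, hd⟩ := d
  change d = _ at h
  subst h
  exact Δ.ne_of_adj hd

theorem eq_of_ends_eq {d d' : Δ.edgeSet} (h : (ofSimple Δ).ends d = (ofSimple Δ).ends d') :
    d = d' := Subtype.ext h

theorem mem_closure_iff_rep (hz : IsProjRep (ofSimple Δ).closure z) {S : Set Δ.edgeSet}
    {d : Δ.edgeSet} : d ∈ (ofSimple Δ).closure S ↔
      (z d).rep ∈ Submodule.span F ((fun x => (z x).rep) '' S) := by
  rw [hz.2, flatSpan_image, submodule_le_iff]

/-- For each node there is a linear form that vanishes on the points of exactly those edges that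
are not incident with the node. -/
theorem exists_nodeForm (hz : IsProjRep (ofSimple Δ).closure z) (v : N) :
    ∃ f : V →ₗ[F] F, ∀ d, f (z d).rep = 0 ↔ v ∉ (ofSimple Δ).ends d := by
  classical
  set G := ofSimple Δ
  let A : Set Δ.edgeSet := {d | v ∉ G.ends d}
  set U : Submodule F V := Submodule.span F ((fun x => (z x).rep) '' A) with hU
  -- Modulo `U`, the chosen edges at `v` form a basis of the span of all edges at `v`; the form `l`
  -- is `1` on each of them.
  obtain ⟨κ, a, -, hspan, hli⟩ := exists_linearIndependent' F
    (fun d : {d // v ∈ G.ends d} => U.mkQ (z d).rep)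
  obtain ⟨l, hl⟩ : ∃ l : V ⧸ U →ₗ[F] F, ∀ k, l (U.mkQ (z (a k)).rep) = 1 := by
    obtain ⟨l, hl⟩ := ((Module.Basis.span hli).constr ℕ fun _ => (1 : F)).exists_extend
    refine ⟨l, fun k => ?_⟩
    have h1 := LinearMap.congr_fun hl (Module.Basis.span hli k)
    rw [Module.Basis.constr_basis, LinearMap.comp_apply, Submodule.subtype_apply,
      Module.Basis.span_apply] at h1
    exact h1
  -- No edge of `A` meets `v`, so `A` joins `v` to no other node.
  have hstar : ∀ d : Δ.edgeSet, v ∈ G.ends d → (z d).rep ∉ U := by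
    intro d hd hdU
    rw [hU, ← mem_closure_iff_rep hz] at hdU
    obtain ⟨u, hu⟩ := hd
    have hj : G.Joined A v u := hdU v u hu
    rcases Relation.ReflTransGen.cases_head hj with h | ⟨c, ⟨e, he, hec⟩, -⟩
    · exact ne_of_ends hu h
    · exact he (by rw [hec]; exact Sym2.mem_mk_left _ _)
  refine ⟨l.comp U.mkQ, fun d => ⟨fun h0 hd => ?_, fun hd => ?_⟩⟩
  · -- the edge is parallel, modulo `U`, to a member of the independent family
    have h1 : (z d).rep ∈ Submodule.span F
        ((fun x => (z x).rep) '' (A ∪ Set.range fun k => (a k : Δ.edgeSet))) := by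
      have h2 : U.mkQ (z d).rep ∈ Submodule.span F (Set.range fun k => U.mkQ (z (a k)).rep) := by
        change _ ∈ Submodule.span F (Set.range ((fun d : {d // v ∈ G.ends d} => U.mkQ (z d).rep) ∘ a))
        rw [hspan]
        exact Submodule.subset_span ⟨⟨d, hd⟩, rfl⟩
      rw [Set.range_comp' U.mkQ, ← Submodule.map_span, ← Submodule.mem_comap,
        Submodule.comap_map_mkQ] at h2
      rw [Set.image_union, Submodule.span_union, ← Set.range_comp]
      exact h2
    rw [← mem_closure_iff_rep hz] at h1
    obtain ⟨u, hu⟩ := hd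
    have hj : G.Joined _ v u := h1 v u hu
    -- After a walk last leaves `v`, by a chosen edge, it stays in `A`. A single chosen edge
    -- therefore suffices to span `d` modulo `U`.
    have hP : ∀ x, G.Joined (A ∪ Set.range fun k => (a k : Δ.edgeSet)) x v → x = v ∨
        ∃ k w, G.ends (a k) = s(v, w) ∧ G.Joined A w x := by
      intro x hx
      induction hx using Relation.ReflTransGen.head_induction_on with
      | refl => exact Or.inl rfl
      | @head x y hxy _ ih =>
        obtain ⟨e, he | ⟨k, rfl⟩, hxy⟩ := hxy
        · rcases ih with rfl | ⟨k, w, hk, hw⟩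
          · exact absurd (by rw [hxy]; exact Sym2.mem_mk_right _ _) he
          · exact Or.inr ⟨k, w, hk, hw.trans (EGraph.Joined.single he hxy).symm⟩
        · have hv := (a k).2
          rw [hxy, Sym2.mem_iff] at hv
          rcases hv with rfl | rfl
          · exact Or.inl rfl
          · exact Or.inr ⟨k, x, hxy.trans Sym2.eq_swap, Relation.ReflTransGen.refl⟩
    rcases hP u hj.symm with h | ⟨k, w, hk, hw⟩
    · exact ne_of_ends hu h.symm
    have h3 : d ∈ G.closure (insert (a k : Δ.edgeSet) A) := by
      refine (EGraph.mem_closure_iff hu).2 ?_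
      exact (EGraph.Joined.single (Set.mem_insert _ _) hk).trans
        (hw.mono (Set.subset_insert _ _))
    rw [mem_closure_iff_rep hz, Set.image_insert_eq, Submodule.mem_span_insert] at h3
    obtain ⟨c, y, hy, hd⟩ := h3
    have hy0 : U.mkQ y = 0 := (Submodule.Quotient.mk_eq_zero U).2 hy
    rw [hd, LinearMap.comp_apply, map_add, map_smul, hy0, add_zero, map_smul, hl] at h0
    have hc : c = 0 := by simpa using h0
    refine hstar d ⟨u, hu⟩ ?_
    rw [hd, hc, zero_smul, zero_add]
    exact hy
  · have : U.mkQ (z d).rep = 0 :=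
      (Submodule.Quotient.mk_eq_zero U).2 (Submodule.subset_span ⟨d, hd, rfl⟩)
    rw [LinearMap.comp_apply, this, map_zero]

/-- A circle has a linear relation whose last coefficient is `-1`. -/
theorem exists_circle_relation (hz : IsProjRep (ofSimple Δ).closure z) {n : ℕ}
    {v : Fin (n + 2) → N} {e : Fin (n + 2) → Δ.edgeSet} (h : (ofSimple Δ).IsClosedPath v e) :
    ∃ c : Fin (n + 2) → F, c (Fin.last _) = -1 ∧ ∑ i, c i • (z (e i)).rep = 0 := by
  have hj : ∀ i : Fin (n + 2),
      (ofSimple Δ).Joined (Set.range fun j : Fin (n + 1) => e j.castSucc) (v 0) (v i) := by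
    intro i
    induction i using Fin.induction with
    | zero => exact Relation.ReflTransGen.refl
    | succ i ih =>
      refine ih.trans (EGraph.Joined.single ⟨i, rfl⟩ ?_)
      rw [h.2.2, Fin.coeSucc_eq_succ]
  have hc : e (Fin.last _) ∈
      (ofSimple Δ).closure (Set.range fun j : Fin (n + 1) => e j.castSucc) := by
    refine (EGraph.mem_closure_iff (h.2.2 _)).2 ?_
    rw [Fin.last_add_one]
    exact (hj _).symm
  rw [mem_closure_iff_rep hz, ← Set.range_comp, Submodule.mem_span_range_iff_exists_fun] at hc
  obtain ⟨c, hc⟩ := hc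
  refine ⟨Fin.snoc c (-1), Fin.snoc_last _ _, ?_⟩
  rw [Fin.sum_univ_castSucc]
  simp only [Fin.snoc_castSucc, Fin.snoc_last]
  simp only [Function.comp_apply] at hc
  rw [hc, neg_one_smul, add_neg_cancel]

/-- The factors `s` are a potential in `Fˣ`; on a circle it comes from the linear relation among its
points. Scaling on the right keeps the forms linear over a skew field. -/
theorem exists_scaling (hz : IsProjRep (ofSimple Δ).closure z) {f : N → V →ₗ[F] F}
    (hf : ∀ v d, f v (z d).rep = 0 ↔ v ∉ (ofSimple Δ).ends d) :
    ∃ s : N → Fˣ, ∀ d a b, (ofSimple Δ).ends d = s(a, b) →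
      f b (z d).rep * s b = -(f a (z d).rep * s a) := by
  classical
  have hfl : ∀ {d : Δ.edgeSet} {a b}, (ofSimple Δ).ends d = s(a, b) → f a (z d).rep ≠ 0 := by
    intro d a b h
    rw [Ne, hf, not_not, h]
    exact Sym2.mem_mk_left _ _
  have hfr : ∀ {d : Δ.edgeSet} {a b}, (ofSimple Δ).ends d = s(a, b) → f b (z d).rep ≠ 0 :=
    fun h => hfl (h.trans Sym2.eq_swap)
  -- the gains, as a function of the edge and the endpoint that it leaves
  have hgex : ∀ (a : N) (d : Δ.edgeSet), ∃ g : Fˣ, ∀ b, (ofSimple Δ).ends d = s(a, b) →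
      (g : F) = -((f b (z d).rep)⁻¹ * f a (z d).rep) := by
    intro a d
    by_cases hd : ∃ b, (ofSimple Δ).ends d = s(a, b)
    · obtain ⟨b, hb⟩ := hd
      refine ⟨Units.mk0 (-((f b (z d).rep)⁻¹ * f a (z d).rep))
        (neg_ne_zero.2 (mul_ne_zero (inv_ne_zero (hfr hb)) (hfl hb))), fun b' hb' => ?_⟩
      obtain rfl : b = b' := Sym2.congr_right.1 (hb.symm.trans hb')
      rfl
    · exact ⟨1, fun b hb => absurd ⟨b, hb⟩ hd⟩
  choose g hg using hgex
  have hginv : ∀ d a b, (ofSimple Δ).ends d = s(a, b) → g b d = (g a d)⁻¹ := fun d a b h => by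
    apply Units.ext
    rw [Units.val_inv_eq_inv_val, hg b d a (h.trans Sym2.eq_swap), hg a d b h, inv_neg,
      mul_inv_rev, inv_inv]
  obtain ⟨s, hs⟩ := EGraph.exists_isPotential (G := ofSimple Δ) (g := g) (S := Set.univ)
    (fun d _ hd => by
      obtain ⟨a, b, hab, h⟩ := exists_ends d
      rw [EGraph.IsHalfEdge, h] at hd
      exact hab hd)
    (fun d a b h _ => hginv d a b h)
    (by
      rintro _ - ⟨n, v, e, h, rfl⟩
      obtain ⟨c, hc, hsum⟩ := exists_circle_relation hz h
      -- Only two edges of the circle meet `v (i + 1)`, so its form leaves two terms of the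
      -- relation.
      have heval : ∀ i, c i * f (v (i + 1)) (z (e i)).rep =
          -(c (i + 1) * f (v (i + 1)) (z (e (i + 1))).rep) := by
        intro i
        have h1 := congrArg (f (v (i + 1))) hsum
        rw [map_sum, map_zero] at h1
        simp only [map_smul, smul_eq_mul] at h1
        have hne : i ≠ i + 1 := fun h' => h.node_ne i (congrArg v h')
        rw [Finset.sum_eq_add i (i + 1) hne ?_ (by simp) (by simp)] at h1
        · exact eq_neg_of_add_eq_zero_left h1
        · rintro j - ⟨hj1, hj2⟩
          rw [(hf _ _).2, mul_zero]
          rw [h.2.2, Sym2.mem_iff, not_or]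
          exact ⟨fun h' => hj2 (h.1 h').symm, fun h' => hj1 (add_right_cancel (h.1 h')).symm⟩
      -- Nonvanishing spreads around the circle from the coefficient `-1`.
      have hstep : ∀ i, c i ≠ 0 → c (i + 1) ≠ 0 := by
        intro i hi h0
        have h1 := heval i
        rw [h0, zero_mul, neg_zero] at h1
        exact mul_ne_zero hi (hfr (h.2.2 i)) h1
      have hc0 : ∀ i, c i ≠ 0 := by
        intro i
        induction i using Fin.induction with
        | zero =>
          rw [← Fin.last_add_one]
          exact hstep _ (by rw [hc]; simp)
        | succ i ih =>
          rw [← Fin.coeSucc_eq_succ]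
          exact hstep _ ih
      have hne : ∀ i, (c i * f (v i) (z (e i)).rep)⁻¹ ≠ 0 := fun i =>
        inv_ne_zero (mul_ne_zero (hc0 i) (hfl (h.2.2 i)))
      have key : ∀ i, Units.mk0 _ (hne (i + 1)) = g (v i) (e i) * Units.mk0 _ (hne i) := by
        intro i
        apply Units.ext
        rw [Units.val_mul, hg _ _ _ (h.2.2 i), Units.val_mk0, Units.val_mk0,
          eq_neg_of_add_eq_zero_right (a := c i * f (v (i + 1)) (z (e i)).rep)
            (b := c (i + 1) * f (v (i + 1)) (z (e (i + 1))).rep)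
            (by rw [heval i, neg_add_cancel]), inv_neg, mul_inv_rev, mul_inv_rev, neg_mul, mul_assoc,
          mul_inv_cancel_left₀ (hfl (h.2.2 i))]
      refine ⟨Function.extend v (fun i => Units.mk0 _ (hne i)) 1, ?_⟩
      rintro _ ⟨i, rfl⟩ a b hab
      rw [h.2.2 i, Sym2.eq_iff] at hab
      rcases hab with ⟨rfl, rfl⟩ | ⟨rfl, rfl⟩
      · rw [h.1.extend_apply, h.1.extend_apply, key]
      · rw [h.1.extend_apply, h.1.extend_apply, key, hginv _ _ _ (h.2.2 i),
          inv_mul_cancel_left])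
  refine ⟨s, fun d a b h => ?_⟩
  rw [hs d trivial a b h, Units.val_mul, hg a d b h, ← mul_assoc, mul_neg,
    mul_inv_cancel_left₀ (hfr h), neg_mul]

/-- A representation of a graphic matroid is, in suitable coordinates, the standard one. -/
theorem exists_standard_coordinates (hz : IsProjRep (ofSimple Δ).closure z) :
    ∃ t : V →ₗ[F] N →₀ F,
      (∀ d a b, (ofSimple Δ).ends d = s(a, b) →
        (z d).submodule.map t = Submodule.span F {diffVec F a b}) ∧
      Set.InjOn t (flatSpan (Set.range z) : Submodule F V) := by
  classical
  choose f hf using exists_nodeForm hz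
  obtain ⟨s, hs⟩ := exists_scaling hz hf
  -- A vector of `V` may have infinitely many nonzero node coordinates. A linear retraction onto the
  -- finitely supported functions leaves the coordinates of the points unchanged.
  obtain ⟨r, hr⟩ := (Finsupp.lcoeFun (α := N) (M := F) (R := F)).exists_leftInverse_of_injective
    (LinearMap.ker_eq_bot.2 DFunLike.coe_injective)
  let t : V →ₗ[F] N →₀ F :=
    r.comp (LinearMap.pi fun v => (LinearMap.toSpanSingleton F F (s v : F)).comp (f v))
  have ht : ∀ d a b, (ofSimple Δ).ends d = s(a, b) →
      ∃ c : F, c ≠ 0 ∧ t (z d).rep = c • diffVec F a b := by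
    intro d a b h
    have hab : a ≠ b := ne_of_ends h
    refine ⟨f b (z d).rep * s b, mul_ne_zero ?_ (s b).ne_zero, ?_⟩
    · rw [Ne, hf, not_not, h]
      exact Sym2.mem_mk_right _ _
    · refine Eq.trans ?_ (LinearMap.congr_fun hr _)
      refine congrArg r (funext fun x => ?_)
      change f x (z d).rep • (s x : F) = (f b (z d).rep * s b) • diffVec F a b x
      rw [smul_eq_mul, smul_eq_mul]
      by_cases hxb : x = b
      · rw [hxb, diffVec_apply_right hab, mul_one]
      by_cases hxa : x = a
      · rw [hxa, ← neg_diffVec, Finsupp.neg_apply, diffVec_apply_right hab.symm, hs d a b h,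
          neg_mul_neg, mul_one]
      · rw [diffVec_apply_of_ne hxa hxb, mul_zero, (hf x d).2, zero_mul]
        rw [h, Sym2.mem_iff, not_or]
        exact ⟨hxa, hxb⟩
  refine ⟨t, fun d a b h => ?_, ?_⟩
  · obtain ⟨c, hc, htc⟩ := ht d a b h
    rw [map_submodule_eq, htc]
    exact Submodule.span_singleton_smul_eq (IsUnit.mk0 c hc) _
  -- A basis of the span is chosen among the points. The ends of a basis edge are not joined by the
  -- other basis edges, so a component form separates its image from theirs.
  · obtain ⟨κ, k, -, hspan, hli⟩ := exists_linearIndependent' F fun d => (z d).rep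
    have hli' : LinearIndependent F (t ∘ fun i => (z (k i)).rep) := by
      rw [linearIndependent_iff_notMem_span]
      intro i hi
      obtain ⟨a, b, -, hab⟩ := exists_ends (k i)
      have hj : ¬ (ofSimple Δ).Joined (k '' (Set.univ \ {i})) a b := by
        intro hj
        have h1 := (EGraph.mem_closure_iff hab).2 hj
        rw [mem_closure_iff_rep hz, Set.image_image] at h1
        exact linearIndependent_iff_notMem_span.1 hli i h1
      have hle : Submodule.span F ((t ∘ fun i => (z (k i)).rep) '' (Set.univ \ {i})) ≤
          LinearMap.ker (componentForm F (ofSimple Δ) (k '' (Set.univ \ {i})) a) := by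
        rw [Submodule.span_le]
        rintro _ ⟨j, hj, rfl⟩
        obtain ⟨x, y, -, hxy⟩ := exists_ends (k j)
        obtain ⟨c, -, hc⟩ := ht _ _ _ hxy
        rw [SetLike.mem_coe, LinearMap.mem_ker, Function.comp_apply, hc, map_smul,
          componentForm_diffVec_of_mem a (Set.mem_image_of_mem k hj) hxy, smul_zero]
      obtain ⟨c, hc0, hc⟩ := ht _ _ _ hab
      have h1 := hle hi
      rw [LinearMap.mem_ker, Function.comp_apply, hc, map_smul,
        componentForm_diffVec_of_not_joined hj] at h1
      simp [hc0] at h1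
    have hd := Submodule.range_ker_disjoint hli'
    have hM : flatSpan (Set.range z) = Submodule.span F (Set.range fun i => (z (k i)).rep) := by
      rw [← Set.image_univ, flatSpan_image, Set.image_univ]
      exact hspan.symm
    rw [hM]
    exact LinearMap.injOn_of_disjoint_ker le_rfl hd

end Unique

end OrthoLift

/-! ### Isomorphisms, standard graphic vectors and simplicity in coordinates. -/

namespace OrthoLift

theorem EGraph.IsCircle.image {N E N' E' : Type*} {G : EGraph N E} {G' : EGraph N' E'}
    (ν : N ≃ N') (ε : E ≃ E') (h : ∀ e, G'.ends (ε e) = (G.ends e).map ν) {C : Set E}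
    (hC : G.IsCircle C) : G'.IsCircle (ε '' C) := by
  obtain ⟨n, v, e, hc, rfl⟩ := hC
  refine ⟨n, ν ∘ v, ε ∘ e, ⟨ν.injective.comp hc.1, ε.injective.comp hc.2.1, fun i => ?_⟩,
    Set.range_comp _ _⟩
  rw [Function.comp_apply, h, hc.2.2]
  rfl

theorem EGraph.isCircle_image_iff {N E N' E' : Type*} {G : EGraph N E} {G' : EGraph N' E'}
    (ν : N ≃ N') (ε : E ≃ E') (h : ∀ e, G'.ends (ε e) = (G.ends e).map ν) {C : Set E} :
    G'.IsCircle (ε '' C) ↔ G.IsCircle C := by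
  refine ⟨fun hC => ?_, IsCircle.image ν ε h⟩
  have := hC.image (G' := G) ν.symm ε.symm fun e => by
    have h1 := h (ε.symm e)
    rw [Equiv.apply_symm_apply] at h1
    rw [h1, Sym2.map_map, Equiv.symm_comp_self, Sym2.map_id]
    rfl
  rwa [ε.symm_image_image] at this

section

variable {F N : Type*} [DivisionRing F]

theorem span_prod_diffVec_swap (a b : N) :
    Submodule.span F {((0 : F), diffVec F a b)} = Submodule.span F {((0 : F), diffVec F b a)} := by
  have h : ∀ a b : N, Submodule.span F {((0 : F), diffVec F a b)} ≤
      Submodule.span F {((0 : F), diffVec F b a)} := fun a b => by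
    rw [Submodule.span_singleton_le_iff_mem, ← neg_mem_iff, Prod.neg_mk, neg_zero, neg_diffVec]
    exact Submodule.mem_span_singleton_self _
  exact le_antisymm (h a b) (h b a)

theorem mem_closure_iff_diffVec {Δ : SimpleGraph N} {u : Δ.edgeSet → F × (N →₀ F)}
    (hu : ∀ d, ∃ a b, (ofSimple Δ).ends d = s(a, b) ∧ u d = (0, diffVec F a b))
    (S : Set Δ.edgeSet) (d : Δ.edgeSet) :
    d ∈ (ofSimple Δ).closure S ↔ u d ∈ Submodule.span F (u '' S) := by
  obtain ⟨a, b, hab, hd⟩ := hu d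
  rw [EGraph.mem_closure_iff hab, hd]
  constructor
  · intro h
    clear hab hd
    induction h with
    | refl => rw [diffVec_self]; exact Submodule.zero_mem _
    | @tail b c _ hbc ih =>
      obtain ⟨e, he, hbc⟩ := hbc
      have h1 : ((0 : F), diffVec F b c) ∈ Submodule.span F (u '' S) := by
        obtain ⟨x, y, hxy, hd⟩ := hu e
        have h2 : ((0 : F), diffVec F x y) ∈ Submodule.span F (u '' S) :=
          hd ▸ Submodule.subset_span ⟨e, he, rfl⟩
        rw [hxy, Sym2.eq_iff] at hbc
        rcases hbc with ⟨rfl, rfl⟩ | ⟨rfl, rfl⟩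
        · exact h2
        · rw [← Submodule.span_singleton_le_iff_mem] at h2 ⊢
          rwa [span_prod_diffVec_swap]
      simpa [diffVec_add] using Submodule.add_mem _ ih h1
  · intro h
    by_contra hj
    have hle : Submodule.span F (u '' S) ≤ LinearMap.ker
        ((componentForm F (ofSimple Δ) S a).comp (LinearMap.snd F F (N →₀ F))) := by
      rw [Submodule.span_le]
      rintro _ ⟨e, he, rfl⟩
      obtain ⟨x, y, hxy, hd⟩ := hu e
      rw [SetLike.mem_coe, LinearMap.mem_ker, LinearMap.comp_apply, hd, LinearMap.snd_apply]
      exact componentForm_diffVec_of_mem _ he hxy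
    have h1 := hle h
    rw [LinearMap.mem_ker, LinearMap.comp_apply, LinearMap.snd_apply,
      componentForm_diffVec_of_not_joined hj] at h1
    exact neg_ne_zero.2 one_ne_zero h1

theorem EGraph.joined_singleton {E : Type*} {G : EGraph N E} {d : E} {a b : N}
    (h : G.Joined {d} a b) (hab : a ≠ b) : G.ends d = s(a, b) := by
  have hm : ∀ {a b : N}, G.Joined {d} a b → a ≠ b → a ∈ G.ends d := by
    intro a b h hab
    rcases Relation.ReflTransGen.cases_head h with h | ⟨c, ⟨e, rfl, hec⟩, -⟩
    · exact absurd h hab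
    · rw [hec]
      exact Sym2.mem_mk_left _ _
  exact (Sym2.mem_and_mem_iff hab).1 ⟨hm h hab, hm h.symm hab.symm⟩

theorem mem_closure_singleton {Δ : SimpleGraph N} {d d' : Δ.edgeSet}
    (h : d ∈ (ofSimple Δ).closure {d'}) : d = d' := by
  obtain ⟨a, b, hab, hd⟩ := exists_ends d
  exact eq_of_ends_eq (hd.trans (EGraph.joined_singleton ((EGraph.mem_closure_iff hd).1 h) hab).symm)

namespace GainGraph

variable {E : Type*} {Φ : GainGraph N E F}

/-- A balanced circle inside two edges would be a digon. Closed singletons make representations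
injective. -/
theorem mem_liftClosure_singleton (hΦ : Φ.biased.IsLiftSimple) {x y : Option E}
    (h : x ∈ Φ.biased.liftClosure {y}) : x = y := by
  have hl : ∀ e, Φ.tail e ≠ Φ.head e := fun e he => hΦ.1 e ((Φ.isHalfEdge_iff e).2 he)
  rcases y with _ | d
  · rw [CircleGraph.liftClosure, if_neg (by simp)] at h
    rcases h with h | ⟨e, he, rfl⟩
    · exact h
    · have hj : Φ.graph.Joined _ _ _ := he _ _ (Φ.ends_graph e)
      rcases Relation.ReflTransGen.cases_head hj with h | ⟨c, ⟨e, he, -⟩, -⟩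
      · exact absurd h (hl e)
      · cases he
  · have hS : (some ⁻¹' {some d} : Set E) = {d} := by ext; simp
    rw [CircleGraph.liftClosure, hS, if_pos] at h
    · obtain ⟨e, he, rfl⟩ := h
      rcases he with rfl | ⟨C, hC, heC, hCS⟩
      · rfl
      · have h1 := EGraph.IsCircle.two_le_encard (Φ.biased.balanced_isCircle C hC)
        by_contra hne
        have h2 : C.encard ≤ 2 := by
          refine (Set.encard_le_encard hCS).trans ?_
          rw [Set.encard_pair fun h => hne (by rw [h])]
        exact hΦ.2 C hC (le_antisymm h2 h1)
    · refine ⟨by simp, fun e _ => hΦ.1 e, fun C hC hcirc => ?_⟩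
      have h1 := (EGraph.IsCircle.two_le_encard hcirc).trans (Set.encard_le_encard hC)
      rw [Set.encard_singleton] at h1
      exact absurd h1 (by norm_num)

theorem liftPt_submodule (x : Option E) :
    (Φ.liftPt x).submodule = Submodule.span F {Φ.liftVec x} :=
  Projectivization.submodule_mk _ _

section Coordinates

variable {V : Type*} [AddCommGroup V] [Module F V] {T : V →ₗ[F] F × (N →₀ F)}
  {ζ : Option E → ℙ F V} {M : Submodule F V}

theorem mem_liftClosure_iff_le (hl : ∀ e, Φ.tail e ≠ Φ.head e) (hT : Set.InjOn T (M : Set V))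
    (hM : ∀ x, (ζ x).submodule ≤ M)
    (h : ∀ x, (ζ x).submodule.map T = Submodule.span F {Φ.liftVec x})
    (S : Set (Option E)) (x : Option E) :
    x ∈ Φ.biased.liftClosure S ↔ (ζ x).submodule ≤ flatSpan (ζ '' S) := by
  rw [mem_liftClosure_iff hl, le_flatSpan_iff_mem_span hT hM h]

theorem injective_of_isLiftSimple (hΦ : Φ.biased.IsLiftSimple) (hT : Set.InjOn T (M : Set V))
    (hM : ∀ x, (ζ x).submodule ≤ M)
    (h : ∀ x, (ζ x).submodule.map T = Submodule.span F {Φ.liftVec x}) :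
    Function.Injective ζ := by
  have hl : ∀ e, Φ.tail e ≠ Φ.head e := fun e he => hΦ.1 e ((Φ.isHalfEdge_iff e).2 he)
  intro x y hxy
  apply mem_liftClosure_singleton hΦ
  rw [mem_liftClosure_iff_le hl hT hM h, hxy]
  exact submodule_le_flatSpan ⟨y, rfl, rfl⟩

theorem isLiftSimple_of_injective (hl : ∀ e, Φ.tail e ≠ Φ.head e) (hT : Set.InjOn T (M : Set V))
    (hM : ∀ x, (ζ x).submodule ≤ M)
    (h : ∀ x, (ζ x).submodule.map T = Submodule.span F {Φ.liftVec x})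
    (hζ : Function.Injective ζ) : Φ.biased.IsLiftSimple := by
  refine ⟨fun e he => hl e ((Φ.isHalfEdge_iff e).1 he), fun C hC h2 => ?_⟩
  obtain ⟨d, e, hne, rfl⟩ := Set.encard_eq_two.1 h2
  have h1 : Φ.liftVec (some d) ∈ Submodule.span F (Φ.liftVec '' (some '' {e})) :=
    mem_span_of_balanced hC (Set.mem_insert _ _) subset_rfl
  rw [Set.image_singleton, ← le_flatSpan_iff_mem_span hT hM h, Set.image_singleton] at h1
  have h3 : flatSpan {ζ (some e)} ≤ (ζ (some e)).submodule := by
    refine iSup₂_le ?_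
    rintro _ rfl
    exact le_rfl
  exact hne (Option.some_injective _ (hζ (eq_of_submodule_le (h1.trans h3))))

theorem mem_balanced_iff_not_le (hT : Set.InjOn T (M : Set V)) (hM : ∀ x, (ζ x).submodule ≤ M)
    (h : ∀ x, (ζ x).submodule.map T = Submodule.span F {Φ.liftVec x}) {C : Set E}
    (hC : Φ.graph.IsCircle C) :
    C ∈ Φ.biased.balanced ↔ ¬ (ζ none).submodule ≤ flatSpan (ζ '' (some '' C)) := by
  rw [mem_balanced_iff_not_mem_span hC, le_flatSpan_iff_mem_span hT hM h]

end Coordinates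

end GainGraph

end

/-- Uniqueness of the edge line removes the choice from `omega`. -/
theorem OrthoFrame.omega_ends {F V N : Type*} [DivisionRing F] [AddCommGroup V] [Module F V]
    (D : OrthoFrame F V N) {P : Set (ℙ F V)} (hP : P ⊆ D.edgePoints) (p : P)
    {d : D.graph.edgeSet} (h : (p : ℙ F V).submodule ≤ D.edgeLine d) :
    (D.omega P hP).ends p = d.1 :=
  congrArg Subtype.val (D.edgeLine_unique (hP p.2).1 (Classical.choose_spec (hP p.2).2) h)

end OrthoLift

/-! ### From analytic to synthetic representations. -/

namespace OrthoLift

variable {F V N E : Type*} [DivisionRing F] [AddCommGroup V] [Module F V]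

/-- The point of `V` over the point `[0, b - a]`, for adjacent nodes `a` and `b`. -/
theorem GainGraph.exists_basePt (Φ : GainGraph N E F) {M : Submodule F V}
    {T : V →ₗ[F] F × (N →₀ F)} (hM : ∀ x, Φ.liftVec x ∈ M.map T)
    (d : Φ.graph.simplification.edgeSet) :
    ∃ p : ℙ F V, p.submodule ≤ M ∧ ∀ a b, d.1 = s(a, b) →
      p.submodule.map T = Submodule.span F {((0 : F), diffVec F a b)} := by
  obtain ⟨d, hd⟩ := d
  induction d with
  | h a b =>
    obtain ⟨hab, e, he⟩ : a ≠ b ∧ ∃ e, Φ.graph.ends e = s(a, b) := hd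
    have h1 := (liftVec_mem_iff he hab _).1 (hM (some e))
    -- Subtracting the multiple of `(1, 0)` given by the gain projects the edge vector into the
    -- base.
    have h2 := Submodule.sub_mem _ h1 (Submodule.smul_mem _ (Φ.gainFrom a e) (hM none))
    have h3 : ((0 : F), diffVec F a b) ∈ M.map T := by simpa [liftVec] using h2
    obtain ⟨y, hy, hyT⟩ := h3
    have hy0 : y ≠ 0 := by
      rintro rfl
      rw [map_zero] at hyT
      exact diffVec_ne_zero hab (congrArg Prod.snd hyT).symm
    refine ⟨Projectivization.mk F y hy0, ?_, fun a' b' h => ?_⟩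
    · rwa [Projectivization.submodule_mk, Submodule.span_singleton_le_iff_mem]
    · rw [Projectivization.submodule_mk, Submodule.map_span, Set.image_singleton, hyT]
      rw [Sym2.eq_iff] at h
      rcases h with ⟨rfl, rfl⟩ | ⟨rfl, rfl⟩
      · rfl
      · exact span_prod_diffVec_swap _ _

theorem range_elim (z : E → ℙ F V) (z₀ : ℙ F V) :
    Set.range (fun x : Option E => x.elim z₀ z) = insert z₀ (Set.range z) := by
  ext p
  constructor
  · rintro ⟨_ | e, rfl⟩
    exacts [Or.inl rfl, Or.inr ⟨e, rfl⟩]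
  · rintro (rfl | ⟨e, rfl⟩)
    exacts [⟨none, rfl⟩, ⟨some e, rfl⟩]

theorem synthetic_of_analytic (Φ : GainGraph N E F) (z : E → ℙ F V) (z₀ : ℙ F V)
    (T : V →ₗ[F] F × (N →₀ F)) (hΦ : Φ.biased.IsLiftSimple)
    (hT : Set.InjOn T (flatSpan (insert z₀ (Set.range z)) : Submodule F V))
    (h₀ : z₀.submodule.map T = (Φ.liftPt none).submodule)
    (hz : ∀ e, (z e).submodule.map T = (Φ.liftPt (some e)).submodule) :
    ∃ D : OrthoFrame F V N,
      D.base = (LinearMap.ker (LinearMap.fst F F (N →₀ F))).comap T ∧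
      D.apex = z₀ ∧
      D.graph = Φ.graph.simplification ∧
      (∀ (a b : N) (h : s(a, b) ∈ D.graph.edgeSet),
        (D.basePt ⟨s(a, b), h⟩).submodule.map T =
          Submodule.span F {((0 : F), Finsupp.single b (1 : F) - Finsupp.single a (1 : F))}) ∧
      (∃ (hP : Set.range z ⊆ D.edgePoints) (f : Φ.biased.Iso (D.omega _ hP)),
        f.node = Equiv.refl N ∧ ∀ e, (f.edge e : ℙ F V) = z e) ∧
      Φ.biased.IsBiasedGraph ∧
      IsProjRep Φ.biased.liftClosure (fun x : Option E => x.elim z₀ z) := by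
  have hl : ∀ e, Φ.tail e ≠ Φ.head e := fun e he => hΦ.1 e ((Φ.isHalfEdge_iff e).2 he)
  set ζ : Option E → ℙ F V := fun x => x.elim z₀ z
  set M : Submodule F V := flatSpan (insert z₀ (Set.range z))
  have hM : ∀ x, (ζ x).submodule ≤ M := fun x =>
    submodule_le_flatSpan (by rw [← range_elim]; exact ⟨x, rfl⟩)
  have h : ∀ x, (ζ x).submodule.map T = Submodule.span F {Φ.liftVec x} := by
    rintro (_ | e)
    · rw [← GainGraph.liftPt_submodule]; exact h₀
    · rw [← GainGraph.liftPt_submodule]; exact hz e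
  have hinj : Function.Injective ζ := Φ.injective_of_isLiftSimple hΦ hT hM h
  have hmem : ∀ x, Φ.liftVec x ∈ M.map T := fun x =>
    Submodule.map_mono (hM x) (by rw [h x]; exact Submodule.mem_span_singleton_self _)
  choose y hyM hy using Φ.exists_basePt hmem
  -- vectors of the standard representation of the simplification
  have hu : ∀ d : Φ.graph.simplification.edgeSet, ∃ u : F × (N →₀ F), ∃ a b,
      (ofSimple Φ.graph.simplification).ends d = s(a, b) ∧ u = (0, diffVec F a b) := fun d => by
    obtain ⟨a, b, -, hab⟩ := exists_ends d
    exact ⟨_, a, b, hab, rfl⟩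
  choose u hu using hu
  have hyu : ∀ d, (y d).submodule.map T = Submodule.span F {u d} := fun d => by
    obtain ⟨a, b, hab, hd⟩ := hu d
    rw [hd]
    exact hy d a b hab
  have hyrep : IsProjRep (ofSimple Φ.graph.simplification).closure y := by
    have hcl : ∀ S d, d ∈ (ofSimple Φ.graph.simplification).closure S ↔
        (y d).submodule ≤ flatSpan (y '' S) := fun S d => by
      rw [mem_closure_iff_diffVec hu, le_flatSpan_iff_mem_span hT hyM hyu]
    refine ⟨fun d d' hd => mem_closure_singleton ?_, hcl⟩
    rw [hcl, hd]
    exact submodule_le_flatSpan ⟨d', rfl, rfl⟩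
  have hfst : ∀ p : ℙ F V, p.submodule ≤ (LinearMap.ker (LinearMap.fst F F (N →₀ F))).comap T ↔
      p.submodule.map T ≤ LinearMap.ker (LinearMap.fst F F (N →₀ F)) := fun p =>
    Submodule.map_le_iff_le_comap.symm
  -- The first coordinate of `T` is a surjective form, since `T` attains every multiple of `(1, 0)`.
  have hcoatom : IsCoatom ((LinearMap.ker (LinearMap.fst F F (N →₀ F))).comap T) := by
    rw [← LinearMap.ker_comp]
    refine LinearMap.isCoatom_ker_of_surjective fun c => ?_
    obtain ⟨x, -, hx⟩ := Submodule.smul_mem _ c (hmem none)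
    exact ⟨x, by rw [LinearMap.comp_apply, hx]; simp [GainGraph.liftVec]⟩
  let D : OrthoFrame F V N :=
    { base := (LinearMap.ker (LinearMap.fst F F (N →₀ F))).comap T
      isCoatom_base := hcoatom
      graph := Φ.graph.simplification
      basePt := y
      basePt_mem := fun d => by
        obtain ⟨a, b, -, hd⟩ := hu d
        rw [hfst, hyu, Submodule.span_singleton_le_iff_mem, hd]
        rfl
      basePt_rep := hyrep
      apex := z₀
      apex_not_mem := fun h' => by
        have h1 := (hfst _).1 h'
        rw [h₀, GainGraph.liftPt_submodule, Submodule.span_singleton_le_iff_mem] at h1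
        exact one_ne_zero (α := F) h1 }
  have hadj : ∀ e, s(Φ.tail e, Φ.head e) ∈ Φ.graph.simplification.edgeSet := fun e =>
    ⟨hl e, e, rfl⟩
  have hline : ∀ e, (z e).submodule ≤ D.edgeLine ⟨_, hadj e⟩ := by
    intro e
    refine (map_le_map_iff_of_injOn hT (hM (some e)) (sup_le (hyM _) (hM none))).1 ?_
    rw [Submodule.map_sup, h (some e), hy _ _ _ rfl, h none,
      Submodule.span_singleton_le_iff_mem, GainGraph.liftVec_some (hl e)]
    refine Submodule.mem_sup.2 ⟨_, Submodule.mem_span_singleton_self _, _,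
      Submodule.smul_mem _ (Φ.gain e) (Submodule.mem_span_singleton_self _), ?_⟩
    simp [GainGraph.liftVec]
  have hP : Set.range z ⊆ D.edgePoints := by
    rintro _ ⟨e, rfl⟩
    refine ⟨fun h' => ?_, _, hline e⟩
    have : some e = none := hinj h'
    simp at this
  have hzinj : Function.Injective z := fun a b hab => Option.some_injective _ (hinj hab)
  let ε : E ≃ Set.range z := Equiv.ofInjective z hzinj
  have hends : ∀ e, (D.omega _ hP).ends (ε e) = (Φ.biased.ends e).map (Equiv.refl N) := fun e => by
    rw [D.omega_ends hP (ε e) (hline e), Equiv.coe_refl, Sym2.map_id]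
    rfl
  refine ⟨D, rfl, rfl, rfl, fun a b h => hy _ _ _ rfl, ⟨hP, ⟨Equiv.refl N, ε, hends, ?_⟩, rfl,
    fun e => rfl⟩, Φ.isBiasedGraph, hinj, fun S x => Φ.mem_liftClosure_iff_le hl hT hM h S x⟩
  intro C
  have himage : Subtype.val '' (ε '' C) = ζ '' (some '' C) := by
    rw [Set.image_image, Set.image_image]
    rfl
  by_cases hC : Φ.graph.IsCircle C
  · rw [Φ.mem_balanced_iff_not_le hT hM h hC, ← himage]
    exact and_iff_right ((EGraph.isCircle_image_iff (Equiv.refl N) ε hends).2 hC)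
  · refine iff_of_false (fun h' => hC ?_) fun h' => hC (Φ.biased.balanced_isCircle C h')
    exact (EGraph.isCircle_image_iff (Equiv.refl N) ε hends).1
      ((D.omega _ hP).balanced_isCircle _ h')

end OrthoLift

/-! ### From synthetic to analytic representations. -/

namespace OrthoLift

variable {F V N N' E : Type*} [DivisionRing F] [AddCommGroup V] [Module F V]

/-- Coordinates for a synthetic orthographic representation. -/
theorem OrthoFrame.exists_coordinates (D : OrthoFrame F V N') (ν : N ≃ N') :
    ∃ T : V →ₗ[F] F × (N →₀ F),
      Set.InjOn T (flatSpan (insert D.apex (Set.range D.basePt)) : Submodule F V) ∧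
      D.base = (LinearMap.ker (LinearMap.fst F F (N →₀ F))).comap T ∧
      D.apex.submodule.map T = Submodule.span F {((1 : F), (0 : N →₀ F))} ∧
      ∀ (a b : N) (h : s(ν a, ν b) ∈ D.graph.edgeSet),
        (D.basePt ⟨s(ν a, ν b), h⟩).submodule.map T =
          Submodule.span F {((0 : F), diffVec F a b)} := by
  obtain ⟨t, ht, htinj⟩ := exists_standard_coordinates D.basePt_rep
  have hapex : D.apex.rep ∉ D.base := fun h => D.apex_not_mem (submodule_le_iff.2 h)
  obtain ⟨l, hl0, hl1⟩ := LinearMap.exists_extend_of_notMem (0 : D.base →ₗ[F] F) hapex 1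
  have hlb : ∀ x ∈ D.base, l x = 0 := fun x hx =>
    LinearMap.congr_fun hl0 ⟨x, hx⟩
  have hker : LinearMap.ker l = D.base := by
    refine (D.isCoatom_base.le_iff.1 hlb).resolve_left fun h => ?_
    have : D.apex.rep ∈ LinearMap.ker l := h ▸ Submodule.mem_top
    rw [LinearMap.mem_ker, hl1] at this
    exact one_ne_zero this
  let m : (N' →₀ F) ≃ₗ[F] (N →₀ F) := Finsupp.domLCongr ν.symm
  have hm : ∀ a b, m (diffVec F (ν a) (ν b)) = diffVec F a b := fun a b => by
    rw [diffVec, map_sub]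
    simp [m, diffVec]
  -- A vector is projected along the apex into the base before the graphic coordinates are taken;
  -- `m` renames the nodes.
  let T : V →ₗ[F] F × (N →₀ F) := l.prod (m.toLinearMap.comp
    (t.comp (LinearMap.id - (LinearMap.toSpanSingleton F V D.apex.rep).comp l)))
  have hTb : ∀ x ∈ D.base, T x = LinearMap.inr F F (N →₀ F) (m (t x)) := fun x hx => by
    simp [T, hlb x hx]
  have hTa : T D.apex.rep = (1, 0) := by simp [T, hl1]
  have hbasele : flatSpan (Set.range D.basePt) ≤ D.base := by
    refine iSup₂_le ?_
    rintro _ ⟨d, rfl⟩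
    exact D.basePt_mem d
  refine ⟨T, ?_, ?_, ?_, ?_⟩
  · have h0 : ∀ x ∈ flatSpan (insert D.apex (Set.range D.basePt)), T x = 0 → x = 0 := by
      intro x hx hTx
      rw [flatSpan, iSup_insert, Projectivization.submodule_eq, Submodule.mem_sup] at hx
      obtain ⟨y, hy, b, hb, rfl⟩ := hx
      obtain ⟨c, rfl⟩ := Submodule.mem_span_singleton.1 hy
      change b ∈ flatSpan (Set.range D.basePt) at hb
      rw [map_add, map_smul, hTa, hTb b (hbasele hb)] at hTx
      have hc : c = 0 := by simpa using congrArg Prod.fst hTx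
      have htb : t b = 0 := by simpa using congrArg Prod.snd hTx
      rw [hc, zero_smul, zero_add]
      exact htinj hb (Submodule.zero_mem _) (by rw [htb, map_zero])
    intro x hx y hy hxy
    exact sub_eq_zero.1 (h0 _ (Submodule.sub_mem _ hx hy) (by rw [map_sub, hxy, sub_self]))
  · rw [← hker]
    rfl
  · rw [map_submodule_eq, hTa]
  · intro a b h
    have h1 := congrArg (Submodule.map ((LinearMap.inr F F (N →₀ F)).comp m.toLinearMap))
      (ht ⟨s(ν a, ν b), h⟩ (ν a) (ν b) rfl)
    rw [map_submodule_eq, Submodule.map_span, Submodule.map_span, Set.image_singleton,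
      Set.image_singleton] at h1
    rw [map_submodule_eq, hTb _ (submodule_le_iff.1 (D.basePt_mem _))]
    refine h1.trans ?_
    rw [LinearMap.comp_apply, LinearEquiv.coe_coe, hm]
    rfl

theorem analytic_of_synthetic (D : OrthoFrame F V N') (P : Set (ℙ F V)) (hP : P ⊆ D.edgePoints)
    (Ω : CircleGraph N E) (f : Ω.Iso (D.omega P hP)) :
    ∃ (Φ : GainGraph N E F) (T : V →ₗ[F] F × (N →₀ F)),
      Φ.biased = Ω ∧ Ω.IsBiasedGraph ∧ Ω.IsLiftSimple ∧
      Set.InjOn T (flatSpan (insert D.apex (Set.range D.basePt)) : Submodule F V) ∧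
      D.base = (LinearMap.ker (LinearMap.fst F F (N →₀ F))).comap T ∧
      D.apex.submodule.map T = (Φ.liftPt none).submodule ∧
      (∀ (a b : N) (h : s(f.node a, f.node b) ∈ D.graph.edgeSet),
        (D.basePt ⟨s(f.node a, f.node b), h⟩).submodule.map T =
          Submodule.span F {((0 : F), Finsupp.single b (1 : F) - Finsupp.single a (1 : F))}) ∧
      (∀ e, (f.edge e : ℙ F V).submodule.map T = (Φ.liftPt (some e)).submodule) ∧
      IsProjRep Ω.liftClosure
        (fun x : Option E => x.elim D.apex fun e => (f.edge e : ℙ F V)) := by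
  obtain ⟨T, hT, hbase, hapex, hpt⟩ := D.exists_coordinates f.node
  set M : Submodule F V := flatSpan (insert D.apex (Set.range D.basePt))
  have hMa : D.apex.submodule ≤ M := submodule_le_flatSpan (Set.mem_insert _ _)
  have hMb : ∀ d, (D.basePt d).submodule ≤ M := fun d =>
    submodule_le_flatSpan (Set.mem_insert_of_mem _ ⟨d, rfl⟩)
  have hMe : ∀ e, (f.edge e : ℙ F V).submodule ≤ M := fun e => by
    obtain ⟨d, hd⟩ := (hP (f.edge e).2).2
    exact hd.trans (sup_le (hMb d) hMa)
  have hedge : ∀ e, ∃ (a b : N) (g : F), Ω.ends e = s(a, b) ∧ a ≠ b ∧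
      (f.edge e : ℙ F V).submodule.map T = Submodule.span F {(g, diffVec F a b)} := by
    intro e
    obtain ⟨hne, d, hd⟩ := hP (f.edge e).2
    obtain ⟨a, b, hab⟩ : ∃ a b, Ω.ends e = s(a, b) := ⟨_, _, (Quot.out_eq (Ω.ends e)).symm⟩
    have hd' : d.1 = s(f.node a, f.node b) := by
      rw [← D.omega_ends hP (f.edge e) hd, f.ends_edge, hab]
      rfl
    obtain ⟨d, hdmem⟩ := d
    obtain rfl : d = _ := hd'
    have h1 := (Submodule.map_mono (f := T) hd)
    rw [OrthoFrame.edgeLine, Submodule.map_sup, hpt a b hdmem, hapex, map_submodule_eq,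
      Submodule.span_singleton_le_iff_mem, Submodule.mem_sup] at h1
    obtain ⟨x, hx, y, hy, hxy⟩ := h1
    obtain ⟨c, rfl⟩ := Submodule.mem_span_singleton.1 hx
    obtain ⟨k, rfl⟩ := Submodule.mem_span_singleton.1 hy
    -- With `c = 0` the point would be the apex. Division by `c` normalizes the node part and yields
    -- the gain `c⁻¹ * k`.
    have hc : c ≠ 0 := by
      rintro rfl
      apply hne
      apply eq_of_submodule_le
      rw [← map_le_map_iff_of_injOn hT (hMe e) hMa, hapex, map_submodule_eq,
        Submodule.span_singleton_le_iff_mem, ← hxy, zero_smul, zero_add]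
      exact hy
    refine ⟨a, b, c⁻¹ * k, hab, ?_, ?_⟩
    · rintro rfl
      exact D.graph.ne_of_adj hdmem rfl
    · have h2 : T (f.edge e : ℙ F V).rep = c • (c⁻¹ * k, diffVec F a b) := by
        rw [← hxy]
        simp [hc]
      rw [map_submodule_eq, h2]
      exact Submodule.span_singleton_smul_eq (IsUnit.mk0 c hc) _
  choose a b g hab hne hg using hedge
  let Φ : GainGraph N E F := ⟨a, b, g⟩
  have hl : ∀ e, Φ.tail e ≠ Φ.head e := hne
  set ζ : Option E → ℙ F V := fun x => x.elim D.apex fun e => (f.edge e : ℙ F V)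
  have hM : ∀ x, (ζ x).submodule ≤ M := by
    rintro (_ | e)
    exacts [hMa, hMe e]
  have h : ∀ x, (ζ x).submodule.map T = Submodule.span F {Φ.liftVec x} := by
    rintro (_ | e)
    · exact hapex
    · rw [Φ.liftVec_some (hl e)]
      exact hg e
  have hinj : Function.Injective ζ := by
    rintro (_ | d) (_ | e) hde
    · rfl
    · exact absurd hde.symm (hP (f.edge e).2).1
    · exact absurd hde (hP (f.edge d).2).1
    · exact congrArg some (f.edge.injective (Subtype.ext hde))
  have hgraph : Φ.graph = Ω.toEGraph := EGraph.ext (funext fun e => (hab e).symm)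
  have hcirc : ∀ C, (D.omega P hP).IsCircle (f.edge '' C) ↔ Φ.graph.IsCircle C := fun C => by
    rw [hgraph]
    exact EGraph.isCircle_image_iff f.node f.edge f.ends_edge
  have hΩ : Φ.biased = Ω := by
    refine CircleGraph.ext (congrArg EGraph.ends hgraph) (Set.ext fun C => ?_)
    rw [← f.balanced_iff C]
    have himage : Subtype.val '' (f.edge '' C) = ζ '' (some '' C) := by
      rw [Set.image_image, Set.image_image]
      rfl
    by_cases hC : Φ.graph.IsCircle C
    · rw [Φ.mem_balanced_iff_not_le hT hM h hC, ← himage]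
      exact (and_iff_right ((hcirc C).2 hC)).symm
    · exact iff_of_false (fun h' => hC (Φ.biased.balanced_isCircle C h')) fun h' =>
        hC ((hcirc C).1 ((D.omega P hP).balanced_isCircle _ h'))
  refine ⟨Φ, T, hΩ, hΩ ▸ Φ.isBiasedGraph, hΩ ▸ Φ.isLiftSimple_of_injective hl hT hM h hinj, hT,
    hbase, ?_, hpt, fun e => ?_, hinj, fun S x => ?_⟩
  · rw [GainGraph.liftPt_submodule]
    exact h none
  · rw [GainGraph.liftPt_submodule]
    exact h (some e)
  · rw [← hΩ]
    exact Φ.mem_liftClosure_iff_le hl hT hM h S x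

end OrthoLift

/-- Synthetic and analytic orthographic representations agree over a skew field `F`.  In both parts
`T` introduces coordinates into the projective geometry of `V`, with the part of it that matters
being embedded in the projective geometry of `F × F ^ N`; for `V = F × F ^ N` and `T` the identity
the first part is about the central projection itself. -/
theorem theoremT {F : Type*} [DivisionRing F] {V : Type*} [AddCommGroup V] [Module F V]
    {N E N' : Type*} :
    -- every central projection of an analytic representation is a synthetic representation,
    -- with base hyperplane `0 × F ^ N` and apex `[1, 0]`
    (∀ (Φ : GainGraph N E F) (z : E → ℙ F V) (z₀ : ℙ F V) (T : V →ₗ[F] F × (N →₀ F)),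
      Φ.biased.IsLiftSimple →
      Set.InjOn T (flatSpan (insert z₀ (Set.range z)) : Submodule F V) →
      z₀.submodule.map T = (Φ.liftPt none).submodule →
      (∀ e, (z e).submodule.map T = (Φ.liftPt (some e)).submodule) →
      ∃ D : OrthoFrame F V N,
        D.base = (LinearMap.ker (LinearMap.fst F F (N →₀ F))).comap T ∧
        D.apex = z₀ ∧
        D.graph = Φ.graph.simplification ∧
        (∀ (a b : N) (h : s(a, b) ∈ D.graph.edgeSet),
          (D.basePt ⟨s(a, b), h⟩).submodule.map T =
            Submodule.span F {((0 : F), Finsupp.single b (1 : F) - Finsupp.single a (1 : F))}) ∧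
        (∃ (hP : Set.range z ⊆ D.edgePoints) (f : Φ.biased.Iso (D.omega _ hP)),
          f.node = Equiv.refl N ∧ ∀ e, (f.edge e : ℙ F V) = z e) ∧
        Φ.biased.IsBiasedGraph ∧
        IsProjRep Φ.biased.liftClosure (fun x : Option E => x.elim z₀ z)) ∧
    -- every synthetic representation is, in suitable coordinates, the central projection of an
    -- analytic representation
    (∀ (D : OrthoFrame F V N') (P : Set (ℙ F V)) (hP : P ⊆ D.edgePoints)
      (Ω : CircleGraph N E) (f : Ω.Iso (D.omega P hP)),
      ∃ (Φ : GainGraph N E F) (T : V →ₗ[F] F × (N →₀ F)),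
        Φ.biased = Ω ∧ Ω.IsBiasedGraph ∧ Ω.IsLiftSimple ∧
        Set.InjOn T (flatSpan (insert D.apex (Set.range D.basePt)) : Submodule F V) ∧
        D.base = (LinearMap.ker (LinearMap.fst F F (N →₀ F))).comap T ∧
        D.apex.submodule.map T = (Φ.liftPt none).submodule ∧
        (∀ (a b : N) (h : s(f.node a, f.node b) ∈ D.graph.edgeSet),
          (D.basePt ⟨s(f.node a, f.node b), h⟩).submodule.map T =
            Submodule.span F {((0 : F), Finsupp.single b (1 : F) - Finsupp.single a (1 : F))}) ∧
        (∀ e, (f.edge e : ℙ F V).submodule.map T = (Φ.liftPt (some e)).submodule) ∧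
        IsProjRep Ω.liftClosure
          (fun x : Option E => x.elim D.apex fun e => (f.edge e : ℙ F V))) :=
  ⟨synthetic_of_analytic, analytic_of_synthetic⟩
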